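/- **Setting.** Let $2^{\mathbb N\times\mathbb N}$ be the space of bit arrays $\omega=(\omega_{m,n})$ with the uniform probability measure $\mathbb P$ (independent fair bits), identified with $(2^{\mathbb N})^{\mathbb N}$ through the rows $\omega_m=(\omega_{m,0},\omega_{m,1},\dots)$. Order $\mathbb N\times\mathbb N$ lexicographically: $(k,\ell)<(m,n)$ iff $k<m$, or $k=m$ and $\ell<n$. Let $\omega_{<(m,n)}=(\omega_{k,\ell}\mid (k,\ell)<(m,n))$ and $\omega_{<m}=\omega_{<(m,0)}=(\omega_0,\dots,\omega_{m-1})$, and let ${}^\frown$ denote concatenation: $\omega_{<(m,n)}{}^\frown\xi$ is the array that has entry $\omega_{k,\ell}$ at $(k,\ell)<(m,n)$, entry $\xi_{0,\ell-n}$ at $(m,\ell)$ for $\ell\ge n$, and entry $\xi_{k-m,\ell}$ at $(k,\ell)$ for $k>m$; and $\omega_{<m}{}^\frown\xi=(\omega_0,\dots,\omega_{m-1},\xi_0,\xi_1,\dots)$. For integrable $f$ put $$\mathbb E_{m,n}(f)(\omega)=\int f(\omega_{<(m,n)}{}^\frown\xi)\,d\mathbb P(\xi),\qquad \mathbb E_{m}(f)(\omega)=\int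 f(\omega_{<m}{}^\frown\xi)\,d\mathbb P(\xi).$$ An *$\mathbb N\times\mathbb N$-indexed martingale* is a family $(M_{m,n})$ of integrable real functions on $2^{\mathbb N\times\mathbb N}$ such that, almost surely, $M_{m,n}(\omega)$ depends only on $(m,n)$ and $\omega_{<(m,n)}$, and $\mathbb E_{k,\ell}(M_{m,n})=M_{k,\ell}$ for all $(k,\ell)\le(m,n)$. It is *computable* if the real number $M_{m,n}(\omega)$ is uniformly computable (i.e. a Cauchy name of it is computed by a single oracle machine) from $(m,n)$ and $\omega_{<(m,n)}$. It is *computable rational-valued* if $M_{m,n}(\omega)\in\mathbb Q$ and, for a standard enumeration $(q_i)_{i\in\mathbb N}$ of $\mathbb Q$, an index $i$ with $M_{m,n}(\omega)=q_i$ is uniformly computable from $(m,n)$ and $\omega_{<(m,n)}$. Computable *$\mathbb N$-indexed martingales* $(M_m)$ are defined in the same way with $m$, $\omega_{<m}$ and $\mathbb E_m$ in place of $(m,n)$, $\omega_{<(m,n)}$ and $\mathbb E_{m,n}$. The array $\omega$ is *Doob random* if $(M_m(\omega))$ converges to a real number as $m\to\infty$ for every nonnegative computable $\mathbb N$-indexed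 martingale $(M_m)$. For a family of reals $x_{m,n}$, say that $x_{m,n}$ converges to $a\in\mathbb R$ as $(m,n)\to\infty$ if for every $\varepsilon>0$ there is $(k,\ell)$ such that $|x_{m,n}-a|<\varepsilon$ for all $(m,n)>(k,\ell)$; it diverges if it converges to no real number; and $\liminf_{m,n}x_{m,n}=\sup_{(k,\ell)}\inf_{(m,n)>(k,\ell)}x_{m,n}\in[-\infty,\infty]$. **Theorem.** For every $\omega\in 2^{\mathbb N\times\mathbb N}$ the following are equivalent: 1. $\omega$ is not Doob random. 2. $(M_{m,n}(\omega))$ diverges as $(m,n)\to\infty$ for some computable nonnegative $\mathbb N\times\mathbb N$-indexed martingale $(M_{m,n})$. 3. $(M_{m,n}(\omega))$ diverges as $(m,n)\to\infty$ for some computable rational-valued nonnegative $\mathbb N\times\mathbb N$-indexed martingale $(M_{m,n})$. 4. $\liminf_{m,n}M_{m,n}(\omega)=\infty$ for some computable rational-valued nonnegative $\mathbb N\times\mathbb N$-indexed martingale $(M_{m,n})$ and some computable function $k:\mathbb N\to\mathbb N$ such that $M_{m,n}=M_{m+1,0}$ for all $m$ and all $n\ge k(m)$. -/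

import Mathlib

open MeasureTheory

namespace DoobArray

/-- The space `2^(ℕ × ℕ)` of bit arrays: `ω (m, n)` is the bit in row `m`, column `n`. Row `m` is the
sequence `n ↦ ω (m, n)`, so the same space is also `(2^ℕ)^ℕ`. -/
abbrev BitArray : Type := ℕ × ℕ → Bool

/-- The law of a fair coin. -/
noncomputable def fairCoin : Measure Bool := (PMF.uniformOfFintype Bool).toMeasure

instance : IsProbabilityMeasure fairCoin := by
  unfold fairCoin
  infer_instance

/-- The uniform probability measure on bit arrays (all bits independent and fair). -/
noncomputable def uniform : Measure BitArray := Measure.infinitePi fun _ : ℕ × ℕ => fairCoin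

/-! ### Times and pasts -/

/-- The strict lexicographic order on `ℕ × ℕ`. -/
def Before (q p : ℕ × ℕ) : Prop := q.1 < p.1 ∨ (q.1 = p.1 ∧ q.2 < p.2)

instance (q p : ℕ × ℕ) : Decidable (Before q p) := by
  unfold Before
  infer_instance

/-- The positions of the bits known at time `(m, n)`, so that `ω_{<(m,n)}` is the restriction
of `ω` to `past (m, n)`. -/
def past (p : ℕ × ℕ) : Set (ℕ × ℕ) := {q | Before q p}

/-- The positions of the bits in the rows `0, …, m - 1`, so that `ω_{<m}` is the restriction
of `ω` to `rowPast m`. -/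
def rowPast (m : ℕ) : Set (ℕ × ℕ) := {q | q.1 < m}

/-- The array `ω` with every bit outside `S` hidden (replaced by `false`): it carries exactly the
information of the restriction of `ω` to `S`. -/
noncomputable def hide (S : Set (ℕ × ℕ)) (ω : BitArray) : BitArray :=
  open Classical in fun q => if q ∈ S then ω q else false

/-- The concatenation of `ω_{<(m,n)}` with `ξ`. -/
def concat (p : ℕ × ℕ) (ω ξ : BitArray) : BitArray := fun q =>
  if Before q p then ω q
  else if q.1 = p.1 then ξ (0, q.2 - p.2)
  else ξ (q.1 - p.1, q.2)

/-- The concatenation of `ω_{<m} = (ω_0, …, ω_{m-1})` with `ξ`. -/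
def rowConcat (m : ℕ) (ω ξ : BitArray) : BitArray := fun q =>
  if q.1 < m then ω q else ξ (q.1 - m, q.2)

/-! ### Conditional expectations and martingales -/

/-- The conditional expectation `𝔼_{m,n}`. -/
noncomputable def expect (p : ℕ × ℕ) (f : BitArray → ℝ) (ω : BitArray) : ℝ :=
  ∫ ξ, f (concat p ω ξ) ∂uniform

/-- The conditional expectation `𝔼_m` on sequences of sequences. -/
noncomputable def rowExpect (m : ℕ) (f : BitArray → ℝ) (ω : BitArray) : ℝ :=
  ∫ ξ, f (rowConcat m ω ξ) ∂uniform

/-- Almost surely, `f ω` depends only on the bits of `ω` with positions in `S`. -/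
def AEDependsOnly (S : Set (ℕ × ℕ)) (f : BitArray → ℝ) : Prop :=
  ∃ G : Set BitArray, (∀ᵐ ω ∂uniform, ω ∈ G) ∧
    ∀ ω ∈ G, ∀ ω' ∈ G, Set.EqOn ω ω' S → f ω = f ω'

/-- `ℕ × ℕ`-indexed martingales, the index set being ordered lexicographically. -/
structure IsMartingale (M : ℕ × ℕ → BitArray → ℝ) : Prop where
  integrable : ∀ p, Integrable (M p) uniform
  adapted : ∀ p, AEDependsOnly (past p) (M p)
  expect_eq : ∀ q p, (Before q p ∨ q = p) → ∀ᵐ ω ∂uniform, expect q (M p) ω = M q ω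

/-- `ℕ`-indexed martingales, in which time `m` reveals the rows `0, …, m - 1`. -/
structure IsRowMartingale (M : ℕ → BitArray → ℝ) : Prop where
  integrable : ∀ m, Integrable (M m) uniform
  adapted : ∀ m, AEDependsOnly (rowPast m) (M m)
  expect_eq : ∀ l m, l ≤ m → ∀ᵐ ω ∂uniform, rowExpect l (M m) ω = M l ω

/-! ### Computability -/

/-- The first `s` bits of `ω`, for the standard computable bijection between `ℕ` and `ℕ × ℕ`. -/
def initialBits (ω : BitArray) (s : ℕ) : List Bool :=
  (List.range s).map fun i => ω (Nat.unpair i)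

/-- `F a ω` is computed, uniformly in `a`, by a single machine with oracle `ω` that halts for all `a`
and `ω`. Here `φ a σ` is the output, if there is one, of the machine on input `a` when it is run for
as many steps as `σ` has bits, with oracle queries answered from `σ`. -/
def IsComputableFunctional {α β : Type} [Primcodable α] [Primcodable β]
    (F : α → BitArray → β) : Prop :=
  ∃ φ : α → List Bool → Option β, Computable₂ φ ∧
    ∀ a ω, (∃ s, φ a (initialBits ω s) = some (F a ω)) ∧
      ∀ s b, φ a (initialBits ω s) = some b → b = F a ω

/-- A standard enumeration of the rationals: the code of the triple `(a, b, c)` is sent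
to `(a - b) / (c + 1)`. -/
def ratEnum (i : ℕ) : ℚ :=
  ((i.unpair.1.unpair.1 : ℚ) - (i.unpair.1.unpair.2 : ℚ)) / ((i.unpair.2 : ℚ) + 1)

/-- `f` is a Cauchy name of the real number `x`. -/
def IsCauchyName (f : ℕ → ℕ) (x : ℝ) : Prop :=
  (∀ i j, i ≤ j → |(ratEnum (f j) : ℝ) - (ratEnum (f i) : ℝ)| ≤ (2 : ℝ)⁻¹ ^ i) ∧
    Filter.Tendsto (fun i => (ratEnum (f i) : ℝ)) Filter.atTop (nhds x)

/-- `M t ω` is, as a real number, uniformly computable from the time `t` and the bits of `ω` with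
positions in `S t`. -/
def ComputablyAdapted {ι : Type} [Primcodable ι] (S : ι → Set (ℕ × ℕ))
    (M : ι → BitArray → ℝ) : Prop :=
  ∃ g : ι × ℕ → BitArray → ℕ, IsComputableFunctional g ∧
    ∀ t ω, IsCauchyName (fun j => g (t, j) (hide (S t) ω)) (M t ω)

/-- `M t ω` is rational, and (an index of) this rational number is uniformly computable from the time
`t` and the bits of `ω` with positions in `S t`. -/
def ComputablyAdaptedRational {ι : Type} [Primcodable ι] (S : ι → Set (ℕ × ℕ))
    (M : ι → BitArray → ℝ) : Prop :=
  ∃ g : ι → BitArray → ℕ, IsComputableFunctional g ∧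
    ∀ t ω, M t ω = (ratEnum (g t (hide (S t) ω)) : ℝ)

/-- Computable `ℕ × ℕ`-indexed martingales. -/
def IsComputableMartingale (M : ℕ × ℕ → BitArray → ℝ) : Prop :=
  IsMartingale M ∧ ComputablyAdapted past M

/-- Computable rational-valued `ℕ × ℕ`-indexed martingales. -/
def IsComputableRationalMartingale (M : ℕ × ℕ → BitArray → ℝ) : Prop :=
  IsMartingale M ∧ ComputablyAdaptedRational past M

/-- Computable `ℕ`-indexed martingales. -/
def IsComputableRowMartingale (M : ℕ → BitArray → ℝ) : Prop :=
  IsRowMartingale M ∧ ComputablyAdapted rowPast M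

/-- `ω` is Doob random: every nonnegative computable `ℕ`-indexed martingale converges on `ω`
(to a real number). -/
def IsDoobRandom (ω : BitArray) : Prop :=
  ∀ M : ℕ → BitArray → ℝ, IsComputableRowMartingale M → (∀ m ξ, 0 ≤ M m ξ) →
    ∃ a : ℝ, Filter.Tendsto (fun m => M m ω) Filter.atTop (nhds a)

/-! ### Limits along the lexicographic order -/

/-- `x (m, n)` converges to `a` as `(m, n) → ∞`. -/
def ConvergesTo (x : ℕ × ℕ → ℝ) (a : ℝ) : Prop :=
  ∀ ε > 0, ∃ q, ∀ p, Before q p → |x p - a| < ε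

/-- `x (m, n)` diverges as `(m, n) → ∞`: it converges to no real number. -/
def Diverges (x : ℕ × ℕ → ℝ) : Prop := ¬ ∃ a : ℝ, ConvergesTo x a

/-- The limit inferior of `x (m, n)` as `(m, n) → ∞`. -/
noncomputable def lexLiminf (x : ℕ × ℕ → ℝ) : EReal :=
  ⨆ q : ℕ × ℕ, ⨅ p : ℕ × ℕ, ⨅ _ : Before q p, (x p : EReal)

end DoobArray

/-!
A function of the array that is computable with every oracle is continuous, and by compactness it
reads a number of bits with a computable bound (`IsComputableFunctional.exists_use`). Hence the
martingale identities, which are required almost surely, hold at every array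
(`IsMartingale.expect_eq_everywhere`), and an `ℕ × ℕ`-indexed computable martingale is determined by
its rows `M (m, 0)` through `M (m, n) = 𝔼_{m,n} (M (m + 1, 0))`. Along the lexicographic order only
the row index matters for limits (`lexAtTop`).

The main step is `exists_lexLiminf_eq_top`: if `N` is a nonnegative computable martingale indexed by
the rows and the family `𝔼_{m,n} (N (m + 1))` diverges on `ω`, then some rational-valued martingale
tends to infinity on `ω`. Each `N (m + 1)` is approximated up to `2 ^ -(m + 1)` by a rational-valued
function of finitely many bits (`approx`), whose conditional expectations are finite averages, so
that they are computable rational numbers, and they no longer change after a computable column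
(`condApprox`). Their increments along the rows, added up from a large enough constant, form a
nonnegative rational `price` that stays within a convergent error of the given martingale
(`price_ge`, `Diverges.price`). Since the price diverges, either it tends to infinity itself, or it
crosses an interval from `a` to `b` with rational end points infinitely often
(`Diverges.eventually_or_crosses`). In the second case one unit is bought whenever the price is
below `a` and sold whenever it is above `b`. Starting with `a`, the capital never becomes negative,
because the loss since a purchase is at most `a`, and each sale secures a gain of `b - a` for ever;
so the capital tends to infinity (`eventually_le_capital`). Both the price and the capital are transforms
of the approximating process by a computable strategy, and all such transforms are computable
rational-valued martingales (`isComputableRationalMartingale_transform`).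

Conversely, the rows of a martingale that tends to infinity on `ω` form an `ℕ`-indexed martingale
that does not converge on `ω`.
-/

namespace DoobArray

/-! ### Computable rational-valued functions -/

/-- A function with rational values is computable if an index of its value with respect to `ratEnum`
can be computed. -/
def IsRatComputable {α : Type} [Primcodable α] (f : α → ℚ) : Prop :=
  ∃ g : α → ℕ, Computable g ∧ ∀ x, ratEnum (g x) = f x

section Computability

variable {α β : Type} [Primcodable α] [Primcodable β]

theorem computable_add {f g : α → ℕ} (hf : Computable f) (hg : Computable g) :
    Computable fun x => f x + g x :=
  Primrec.nat_add.to_comp.comp hf hg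

theorem computable_mul {f g : α → ℕ} (hf : Computable f) (hg : Computable g) :
    Computable fun x => f x * g x :=
  Primrec.nat_mul.to_comp.comp hf hg

theorem computable_natPair {f g : α → ℕ} (hf : Computable f) (hg : Computable g) :
    Computable fun x => Nat.pair (f x) (g x) :=
  Primrec₂.natPair.to_comp.comp hf hg

theorem computable_decide_lt {f g : α → ℕ} (hf : Computable f) (hg : Computable g) :
    Computable fun x => decide (f x < g x) :=
  Primrec.nat_lt.decide.to_comp.comp hf hg

theorem primrec_two_pow : Primrec fun n : ℕ => 2 ^ n := by
  refine ((Primrec.nat_rec₁ 1 (Primrec.nat_mul.comp (Primrec.const 2) Primrec.snd).to₂)).of_eq ?_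
  intro n
  induction n with
  | zero => rfl
  | succ n ih => simp only [pow_succ'] at ih ⊢; rw [← ih]

theorem primrec_testBit : Primrec₂ fun x i : ℕ => x.testBit i := by
  have h : Primrec₂ fun x i : ℕ => decide (1 ≤ x / 2 ^ i % 2) :=
    Primrec.nat_le.decide.comp (Primrec.const 1)
      (Primrec.nat_mod.comp
        (Primrec.nat_div.comp Primrec.fst (primrec_two_pow.comp Primrec.snd)) (Primrec.const 2))
  refine h.of_eq fun x i => ?_
  rw [Nat.testBit_eq_decide_div_mod_eq]
  congr 1
  exact propext (by omega)

theorem computable_ball {p : α → ℕ → Bool} {n : α → ℕ} (hp : Computable₂ p)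
    (hn : Computable n) : Computable fun x => decide (∀ i < n x, p x i = true) := by
  have h : Computable fun x => Nat.rec (motive := fun _ => Bool) true
      (fun i b => b && p x i) (n x) :=
    Computable.nat_rec hn (Computable.const true)
      (Primrec.and.to_comp.comp (Computable.snd.comp Computable.snd)
        (hp.comp Computable.fst (Computable.fst.comp Computable.snd))).to₂
  refine h.of_eq fun x => ?_
  induction n x with
  | zero => simp
  | succ k ih =>
    simp only [ih]
    simp only [Nat.lt_succ_iff_lt_or_eq, or_imp, forall_and, forall_eq, Bool.decide_and,
      Bool.decide_eq_true]

/-- Unbounded search for the least witness of a decidable property that always has one. -/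
theorem exists_computable_of_forall_exists {p : α → ℕ → Bool} (hp : Computable₂ p)
    (h : ∀ x, ∃ n, p x n = true) : ∃ S : α → ℕ, Computable S ∧ ∀ x, p x (S x) = true := by
  refine ⟨fun x => Nat.find (h x), ?_, fun x => Nat.find_spec (h x)⟩
  refine (Partrec.rfind hp.partrec₂).of_eq_tot fun x => ?_
  rw [Nat.mem_rfind]
  constructor
  · simpa using (Nat.find_spec (h x))
  · intro m hm
    have := Nat.find_min (h x) hm
    simpa using this

theorem exists_rat_eq_triple (q : ℚ) :
    ∃ a b c : ℕ, q = ((a : ℚ) - (b : ℚ)) / ((c : ℚ) + 1) := by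
  refine ⟨q.num.toNat, (-q.num).toNat, q.den - 1, ?_⟩
  have h1 : ((q.den - 1 : ℕ) : ℚ) + 1 = q.den := by
    have := q.den_pos
    rw [← Nat.cast_add_one]; congr 1; omega
  have h2 : ((q.num.toNat : ℕ) : ℚ) - ((-q.num).toNat : ℕ) = q.num := by
    have : ((q.num.toNat : ℕ) : ℤ) - ((-q.num).toNat : ℕ) = q.num := by omega
    exact_mod_cast this
  rw [h1, h2, Rat.num_div_den]

namespace IsRatComputable

theorem of_triple {a b c : α → ℕ} (ha : Computable a) (hb : Computable b) (hc : Computable c) :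
    IsRatComputable fun x => ((a x : ℚ) - (b x : ℚ)) / ((c x : ℚ) + 1) :=
  ⟨fun x => Nat.pair (Nat.pair (a x) (b x)) (c x),
    computable_natPair (computable_natPair ha hb) hc, fun x => by simp [ratEnum]⟩

theorem exists_triple {f : α → ℚ} (hf : IsRatComputable f) :
    ∃ a b c : α → ℕ, Computable a ∧ Computable b ∧ Computable c ∧
      ∀ x, f x = ((a x : ℚ) - (b x : ℚ)) / ((c x : ℚ) + 1) := by
  obtain ⟨g, hg, h⟩ := hf
  refine ⟨fun x => (g x).unpair.1.unpair.1, fun x => (g x).unpair.1.unpair.2,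
    fun x => (g x).unpair.2, ?_, ?_, ?_, fun x => (h x).symm⟩
  · exact Computable.fst.comp (Computable.unpair.comp (Computable.fst.comp
      (Computable.unpair.comp hg)))
  · exact Computable.snd.comp (Computable.unpair.comp (Computable.fst.comp
      (Computable.unpair.comp hg)))
  · exact Computable.snd.comp (Computable.unpair.comp hg)

theorem of_eq {f g : α → ℚ} (hf : IsRatComputable f) (h : ∀ x, f x = g x) : IsRatComputable g :=
  (funext h : f = g) ▸ hf

theorem comp {f : β → ℚ} (hf : IsRatComputable f) {g : α → β} (hg : Computable g) :
    IsRatComputable fun x => f (g x) := by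
  obtain ⟨k, hk, h⟩ := hf
  exact ⟨fun x => k (g x), hk.comp hg, fun x => h _⟩

theorem ratEnum_comp {g : α → ℕ} (hg : Computable g) : IsRatComputable fun x => ratEnum (g x) :=
  ⟨g, hg, fun _ => rfl⟩

theorem const (q : ℚ) : IsRatComputable fun _ : α => q := by
  obtain ⟨a, b, c, h⟩ := exists_rat_eq_triple q
  exact (of_triple (Computable.const a) (Computable.const b) (Computable.const c)).of_eq
    fun _ => h.symm

theorem add {f g : α → ℚ} (hf : IsRatComputable f) (hg : IsRatComputable g) :
    IsRatComputable fun x => f x + g x := by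
  obtain ⟨a, b, c, ha, hb, hc, h⟩ := hf.exists_triple
  obtain ⟨a', b', c', ha', hb', hc', h'⟩ := hg.exists_triple
  have hs := Computable.succ.comp hc
  have hs' := Computable.succ.comp hc'
  refine (of_triple (computable_add (computable_mul ha hs') (computable_mul ha' hs))
    (computable_add (computable_mul hb hs') (computable_mul hb' hs))
    (Computable.pred.comp (computable_mul hs hs'))).of_eq fun x => ?_
  rw [h, h']
  have e : (((c x).succ * (c' x).succ).pred : ℚ) + 1 = ((c x : ℚ) + 1) * ((c' x : ℚ) + 1) := by
    have : ((c x).succ * (c' x).succ).pred + 1 = (c x).succ * (c' x).succ :=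
      Nat.succ_pred_eq_of_pos (Nat.mul_pos (Nat.succ_pos _) (Nat.succ_pos _))
    exact_mod_cast this
  have h1 : ((c x : ℚ) + 1) ≠ 0 := by positivity
  have h2 : ((c' x : ℚ) + 1) ≠ 0 := by positivity
  simp only [e]
  push_cast
  field_simp
  ring

theorem neg {f : α → ℚ} (hf : IsRatComputable f) : IsRatComputable fun x => -f x := by
  obtain ⟨a, b, c, ha, hb, hc, h⟩ := hf.exists_triple
  refine (of_triple hb ha hc).of_eq fun x => ?_
  rw [h]; ring

theorem sub {f g : α → ℚ} (hf : IsRatComputable f) (hg : IsRatComputable g) :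
    IsRatComputable fun x => f x - g x :=
  (hf.add hg.neg).of_eq fun _ => (sub_eq_add_neg _ _).symm

theorem div_two_pow {f : α → ℚ} (hf : IsRatComputable f) {n : α → ℕ} (hn : Computable n) :
    IsRatComputable fun x => f x / 2 ^ n x := by
  obtain ⟨a, b, c, ha, hb, hc, h⟩ := hf.exists_triple
  refine (of_triple ha hb (Computable.pred.comp (computable_mul (Computable.succ.comp hc)
    (primrec_two_pow.to_comp.comp hn)))).of_eq fun x => ?_
  have e : (((c x).succ * 2 ^ n x).pred : ℚ) + 1 = ((c x : ℚ) + 1) * 2 ^ n x := by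
    have : ((c x).succ * 2 ^ n x).pred + 1 = (c x).succ * 2 ^ n x :=
      Nat.succ_pred_eq_of_pos (Nat.mul_pos (Nat.succ_pos _) (by positivity))
    exact_mod_cast this
  simp only [e, h, div_div]

theorem cond {c : α → Bool} {f g : α → ℚ} (hc : Computable c) (hf : IsRatComputable f)
    (hg : IsRatComputable g) : IsRatComputable fun x => if c x = true then f x else g x := by
  obtain ⟨k, hk, h⟩ := hf
  obtain ⟨k', hk', h'⟩ := hg
  refine ⟨_, Computable.cond hc hk hk', fun x => ?_⟩
  rcases hcx : c x <;> simp [hcx, h, h']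

theorem sum {f : α → ℕ → ℚ} (hf : IsRatComputable fun x : α × ℕ => f x.1 x.2) {n : α → ℕ}
    (hn : Computable n) : IsRatComputable fun x => ∑ i ∈ Finset.range (n x), f x i := by
  -- the step of the recursion adds two indices
  obtain ⟨ad, had, ead⟩ := ((ratEnum_comp Computable.fst).add (ratEnum_comp Computable.snd) :
    IsRatComputable fun x : ℕ × ℕ => ratEnum x.1 + ratEnum x.2)
  obtain ⟨z, -, ez⟩ := (const 0 : IsRatComputable fun _ : ℕ => (0 : ℚ))
  obtain ⟨k, hk, ek⟩ := hf
  refine ⟨fun x => Nat.rec (motive := fun _ => ℕ) (z 0) (fun i s => ad (s, k (x, i))) (n x),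
    Computable.nat_rec hn (Computable.const (z 0))
      (had.comp (Computable.pair (Computable.snd.comp Computable.snd)
        (hk.comp (Computable.pair Computable.fst (Computable.fst.comp Computable.snd))))).to₂,
    fun x => ?_⟩
  dsimp only
  induction n x with
  | zero => simpa using ez 0
  | succ i ih =>
    rw [Finset.sum_range_succ, ← ih]
    simp only [ead, ek]

theorem decide_lt {f g : α → ℚ} (hf : IsRatComputable f) (hg : IsRatComputable g) :
    Computable fun x => decide (f x < g x) := by
  obtain ⟨a, b, c, ha, hb, hc, h⟩ := hf.exists_triple
  obtain ⟨a', b', c', ha', hb', hc', h'⟩ := hg.exists_triple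
  have hs := Computable.succ.comp hc
  have hs' := Computable.succ.comp hc'
  refine (computable_decide_lt
    (computable_add (computable_mul ha hs') (computable_mul hb' hs))
    (computable_add (computable_mul ha' hs) (computable_mul hb hs'))).of_eq fun x => ?_
  rw [h, h']
  congr 1
  have h1 : (0 : ℚ) < (c x : ℚ) + 1 := by positivity
  have h2 : (0 : ℚ) < (c' x : ℚ) + 1 := by positivity
  rw [div_lt_div_iff₀ h1 h2, ← Nat.cast_lt (α := ℚ)]
  push_cast
  refine propext ⟨fun h => ?_, fun h => ?_⟩ <;> linarith

end IsRatComputable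

end Computability

/-! ### Initial bits -/

@[simp] theorem length_initialBits (ω : BitArray) (s : ℕ) : (initialBits ω s).length = s := by
  simp [initialBits]

theorem take_initialBits (ω : BitArray) (s i : ℕ) :
    (initialBits ω s).take i = initialBits ω (min i s) := by
  simp [initialBits, ← List.map_take, List.take_range]

theorem initialBits_eq_iff {ω ξ : BitArray} {s : ℕ} :
    initialBits ω s = initialBits ξ s ↔ ∀ i < s, ω (Nat.unpair i) = ξ (Nat.unpair i) := by
  simp [initialBits]

theorem initialBits_eq_mono {ω ξ : BitArray} {s t : ℕ} (hst : s ≤ t)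
    (h : initialBits ω t = initialBits ξ t) : initialBits ω s = initialBits ξ s :=
  initialBits_eq_iff.2 fun i hi => initialBits_eq_iff.1 h i (hi.trans_le hst)

theorem getD_initialBits (ω : BitArray) {s i : ℕ} (hi : i < s) :
    (initialBits ω s).getD i false = ω (Nat.unpair i) := by
  simp [initialBits, hi]

/-- The array whose bits are those of the list `σ`, continued by `false`. -/
def ofList (σ : List Bool) : BitArray := fun q => σ.getD (Nat.pair q.1 q.2) false

@[simp] theorem ofList_unpair (σ : List Bool) (i : ℕ) :
    ofList σ (Nat.unpair i) = σ.getD i false := by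
  simp [ofList]

theorem initialBits_ofList_initialBits (ω : BitArray) {s t : ℕ} (hst : s ≤ t) :
    initialBits (ofList (initialBits ω t)) s = initialBits ω s := by
  rw [initialBits_eq_iff]
  intro i hi
  have := getD_initialBits ω (hi.trans_le hst)
  simpa [ofList] using this

/-- The array whose bits are the binary digits of `x`. -/
def ofNat (x : ℕ) : BitArray := fun q => x.testBit (Nat.pair q.1 q.2)

@[simp] theorem ofNat_unpair (x i : ℕ) : ofNat x (Nat.unpair i) = x.testBit i := by
  simp [ofNat]

/-- The numbers below `2 ^ s` list the possible values of the first `s` bits, each one once. -/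
theorem existsUnique_initialBits_ofNat (ω : BitArray) (s : ℕ) :
    ∃! x, x < 2 ^ s ∧ initialBits (ofNat x) s = initialBits ω s := by
  refine ⟨Nat.ofBits fun i : Fin s => ω (Nat.unpair i), ⟨Nat.ofBits_lt_two_pow _, ?_⟩, ?_⟩
  · rw [initialBits_eq_iff]
    intro i hi
    rw [ofNat_unpair, Nat.testBit_ofBits_lt _ _ hi]
  · rintro y ⟨hy, h⟩
    rw [initialBits_eq_iff] at h
    refine Nat.eq_of_testBit_eq fun i => ?_
    rcases lt_or_ge i s with hi | hi
    · rw [Nat.testBit_ofBits_lt _ _ hi, ← h i hi, ofNat_unpair]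
    · rw [Nat.testBit_ofBits_ge _ _ hi]
      exact Nat.testBit_lt_two_pow (hy.trans_le (Nat.pow_le_pow_right (by norm_num) hi))

theorem continuous_initialBits {X : Type} [TopologicalSpace X] (F : List Bool → X) (s : ℕ) :
    Continuous fun ω => F (initialBits ω s) := by
  have h : IsLocallyConstant fun ω => initialBits ω s := by
    have : (fun ω => initialBits ω s) =
        (fun v : Fin s → Bool => List.ofFn v) ∘ fun ω i => ω (Nat.unpair i) := by
      funext ω
      refine List.ext_getElem (by simp) fun i h1 h2 => ?_
      simp [initialBits]
    rw [this]
    exact (IsLocallyConstant.of_discrete _).comp_continuous (by fun_prop)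
  exact (h.comp F).continuous

/-- Every neighbourhood of `ω` contains all arrays with the same first `s` bits, for some `s`. -/
theorem exists_initialBits_subset {U : Set BitArray} (hU : IsOpen U) {ω : BitArray} (hω : ω ∈ U) :
    ∃ s, ∀ ξ, initialBits ξ s = initialBits ω s → ξ ∈ U := by
  obtain ⟨I, u, hu, hsub⟩ := isOpen_pi_iff.1 hU ω hω
  refine ⟨I.sup (fun q => Nat.pair q.1 q.2) + 1, fun ξ h => hsub fun q hq => ?_⟩
  have hlt : Nat.pair q.1 q.2 < I.sup (fun q => Nat.pair q.1 q.2) + 1 :=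
    Nat.lt_succ_of_le (Finset.le_sup (f := fun q : ℕ × ℕ => Nat.pair q.1 q.2) hq)
  have := initialBits_eq_iff.1 h _ hlt
  rw [Nat.unpair_pair] at this
  rw [this]
  exact (hu q hq).2

/-! ### Computable functionals use computably many bits -/

section Functional

variable {α : Type}

/-- The output of the first prefix of `σ` of length at most `k` on which the machine `φ` halts. -/
def firstOutput (φ : α → List Bool → Option ℕ) (a : α) (σ : List Bool) (k : ℕ) : Option ℕ :=
  Nat.rec (φ a (σ.take 0)) (fun i o => o <|> φ a (σ.take (i + 1))) k

theorem firstOutput_succ (φ : α → List Bool → Option ℕ) (a : α) (σ : List Bool) (k : ℕ) :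
    firstOutput φ a σ (k + 1) = (firstOutput φ a σ k <|> φ a (σ.take (k + 1))) := rfl

theorem computable_firstOutput [Primcodable α] {φ : α → List Bool → Option ℕ} (hφ : Computable₂ φ) :
    Computable fun x : (α × List Bool) × ℕ => firstOutput φ x.1.1 x.1.2 x.2 := by
  refine Computable.nat_rec Computable.snd (hφ.comp (Computable.fst.comp Computable.fst)
    (Primrec.list_take.to_comp.comp (Computable.const 0) (Computable.snd.comp Computable.fst)))
    (Primrec.option_orElse.to_comp.comp (Computable.snd.comp Computable.snd)
      (hφ.comp (Computable.fst.comp (Computable.fst.comp Computable.fst))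
        (Primrec.list_take.to_comp.comp
          (Computable.succ.comp (Computable.fst.comp Computable.snd))
          (Computable.snd.comp (Computable.fst.comp Computable.fst))))).to₂

theorem exists_eq_of_firstOutput {φ : α → List Bool → Option ℕ} {a : α} {σ : List Bool} {k b : ℕ}
    (h : firstOutput φ a σ k = some b) : ∃ i, φ a (σ.take i) = some b := by
  induction k with
  | zero => exact ⟨0, h⟩
  | succ k ih =>
    rw [firstOutput_succ] at h
    rcases ho : firstOutput φ a σ k with _ | c
    · rw [ho] at h
      exact ⟨k + 1, by simpa using h⟩
    · rw [ho] at h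
      exact ih (by simpa [ho] using h)

theorem isSome_firstOutput {φ : α → List Bool → Option ℕ} {a : α} {σ : List Bool} {i k : ℕ}
    (hik : i ≤ k) (h : (φ a (σ.take i)).isSome) : (firstOutput φ a σ k).isSome := by
  induction k with
  | zero =>
    obtain rfl : i = 0 := by omega
    exact h
  | succ k ih =>
    rw [firstOutput_succ]
    rcases Nat.lt_or_ge i (k + 1) with hlt | hge
    · simp [ih (by omega)]
    · obtain rfl : i = k + 1 := by omega
      simp [h]

/-- By compactness, a machine that halts with every oracle reads a bounded number of bits. -/
theorem exists_bound_of_forall_exists {φ : List Bool → Option ℕ}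
    (h : ∀ ω : BitArray, ∃ s, (φ (initialBits ω s)).isSome) :
    ∃ S, ∀ ω : BitArray, ∃ s ≤ S, (φ (initialBits ω s)).isSome := by
  let U : ℕ → Set BitArray := fun s => {ω | (φ (initialBits ω s)).isSome = true}
  have hU : ∀ s, IsOpen (U s) := fun s =>
    (isOpen_discrete {true}).preimage (continuous_initialBits (fun σ => (φ σ).isSome) s)
  obtain ⟨t, ht⟩ := isCompact_univ.elim_finite_subcover U hU fun ω _ =>
    Set.mem_iUnion.2 (h ω)
  refine ⟨t.sup id, fun ω => ?_⟩
  obtain ⟨s, hs, hω⟩ := Set.mem_iUnion₂.1 (ht (Set.mem_univ ω))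
  exact ⟨s, Finset.le_sup (f := id) hs, hω⟩

/-- A computable functional has a computable bound on the number of bits that it reads, and it is a
computable function of that many initial bits. The bound is found by searching for a number `S` such
that the machine halts on all `2 ^ S` lists of `S` bits. -/
theorem IsComputableFunctional.exists_use [Primcodable α] {F : α → BitArray → ℕ}
    (hF : IsComputableFunctional F) :
    ∃ S : α → ℕ, Computable S ∧ ∃ V : α → List Bool → ℕ, Computable₂ V ∧
      ∀ a ω, F a ω = V a (initialBits ω (S a)) := by
  obtain ⟨φ, hφ, h⟩ := hF
  have hfo := computable_firstOutput hφ
  have hlist : Computable fun x : ℕ × ℕ => initialBits (ofNat x.1) x.2 :=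
    (Primrec.list_map (Primrec.list_range.comp Primrec.snd)
      (primrec_testBit.comp (Primrec.fst.comp Primrec.fst) Primrec.snd).to₂).to_comp.of_eq
      fun x => by simp [initialBits]
  have hp : Computable₂ fun (a : α) (S : ℕ) => decide (∀ x < 2 ^ S,
      (firstOutput φ a (initialBits (ofNat x) S) S).isSome = true) := by
    have hpair : Computable fun z : (α × ℕ) × ℕ => (z.2, z.1.2) :=
      Computable.pair Computable.snd (Computable.snd.comp Computable.fst)
    have hbits := hlist.comp hpair
    have harg : Computable fun z : (α × ℕ) × ℕ =>
        ((z.1.1, initialBits (ofNat z.2) z.1.2), z.1.2) :=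
      Computable.pair (Computable.pair (Computable.fst.comp Computable.fst)
        hbits)
        (Computable.snd.comp Computable.fst)
    have hout := hfo.comp harg
    have hsome : Computable fun z : (α × ℕ) × ℕ =>
        (firstOutput φ z.1.1 (initialBits (ofNat z.2) z.1.2) z.1.2).isSome :=
      Primrec.option_isSome.to_comp.comp hout
    exact computable_ball (α := α × ℕ) (n := fun y => 2 ^ y.2) hsome.to₂
      (primrec_two_pow.to_comp.comp Computable.snd)
  have hex : ∀ a, ∃ S, decide (∀ x < 2 ^ S,
      (firstOutput φ a (initialBits (ofNat x) S) S).isSome = true) = true := by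
    intro a
    obtain ⟨S, hS⟩ := exists_bound_of_forall_exists (φ := φ a) fun ω => by
      obtain ⟨s, hs⟩ := (h a ω).1
      exact ⟨s, by simp [hs]⟩
    refine ⟨S, ?_⟩
    rw [decide_eq_true_iff]
    intro x _
    obtain ⟨s, hs, hx⟩ := hS (ofNat x)
    exact isSome_firstOutput hs (by rwa [take_initialBits, min_eq_left hs])
  obtain ⟨S, hS, hSp⟩ := exists_computable_of_forall_exists hp hex
  refine ⟨S, hS, fun a σ => (firstOutput φ a σ (S a)).getD 0, ?_, fun a ω => ?_⟩
  · have hout := hfo.comp (Computable.pair Computable.id (hS.comp Computable.fst))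
    exact Computable.option_getD hout (Computable.const 0)
  · dsimp only
    obtain ⟨x, ⟨hx, hxω⟩, -⟩ := existsUnique_initialBits_ofNat ω (S a)
    have := of_decide_eq_true (hSp a) x hx
    rw [hxω] at this
    obtain ⟨b, hb⟩ := Option.isSome_iff_exists.1 this
    obtain ⟨i, hi⟩ := exists_eq_of_firstOutput hb
    rw [take_initialBits] at hi
    rw [hb, Option.getD_some, (h a ω).2 _ _ hi]

theorem isComputableFunctional_of_initialBits [Primcodable α] {T : α → ℕ} (hT : Computable T)
    {G : α × List Bool → ℕ} (hG : Computable G) :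
    IsComputableFunctional fun a ω => G (a, initialBits ω (T a)) := by
  refine ⟨fun a σ => if decide (σ.length < T a) = true then none
    else some (G (a, σ.take (T a))), ?_, fun a ω => ⟨⟨T a, ?_⟩, fun s b hb => ?_⟩⟩
  · refine (Computable.cond (computable_decide_lt (Computable.list_length.comp Computable.snd)
      (hT.comp Computable.fst)) (Computable.const none) (Computable.option_some.comp
        (hG.comp (Computable.pair Computable.fst (Primrec.list_take.to_comp.comp
          (hT.comp Computable.fst) Computable.snd))))).of_eq fun x => ?_
    exact Bool.cond_eq_ite ..
  · simp [take_initialBits]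
  · have hs : ¬ s < T a := fun hs => by simp [hs] at hb
    simp only [length_initialBits, hs, decide_false, Bool.false_eq_true, if_false,
      take_initialBits, min_eq_left (not_lt.1 hs), Option.some.injEq] at hb
    exact hb.symm

theorem IsComputableFunctional.comp [Primcodable α] {β : Type} [Primcodable β]
    {F : α → BitArray → ℕ}
    (hF : IsComputableFunctional F) {f : β → α} (hf : Computable f) :
    IsComputableFunctional fun b ω => F (f b) ω := by
  obtain ⟨φ, hφ, h⟩ := hF
  exact ⟨fun b σ => φ (f b) σ, hφ.comp (hf.comp Computable.fst) Computable.snd, fun b ω => h _ ω⟩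

end Functional

/-! ### Limits along the lexicographic order -/

/-- The neighbourhoods of infinity in the lexicographic order: only the row index matters. -/
def lexAtTop : Filter (ℕ × ℕ) := Filter.comap Prod.fst Filter.atTop

theorem eventually_lexAtTop {P : ℕ × ℕ → Prop} :
    (∀ᶠ p in lexAtTop, P p) ↔ ∃ k, ∀ m n, k ≤ m → P (m, n) := by
  simp only [lexAtTop, Filter.eventually_comap, Filter.eventually_atTop]
  exact ⟨fun ⟨k, h⟩ => ⟨k, fun m n hm => h m hm _ rfl⟩,
    fun ⟨k, h⟩ => ⟨k, fun m hm ⟨m', n⟩ e => h m' n (hm.trans_eq e.symm)⟩⟩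

theorem eventually_lexAtTop_iff_before {P : ℕ × ℕ → Prop} :
    (∀ᶠ p in lexAtTop, P p) ↔ ∃ q, ∀ p, Before q p → P p := by
  rw [eventually_lexAtTop]
  constructor
  · rintro ⟨k, h⟩
    refine ⟨(k, 0), fun p hp => h p.1 p.2 ?_⟩
    rcases hp with hp | hp
    · exact hp.le
    · exact hp.1.le
  · rintro ⟨q, h⟩
    exact ⟨q.1 + 1, fun m n hm => h (m, n) (Or.inl hm)⟩

theorem frequently_lexAtTop {P : ℕ × ℕ → Prop} (h : ∃ᶠ p in lexAtTop, P p) (k : ℕ) :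
    ∃ m n, k < m ∧ P (m, n) := by
  by_contra! hc
  exact h (eventually_lexAtTop.2 ⟨k + 1, fun m n hm => hc m n hm⟩)

theorem convergesTo_iff_tendsto {x : ℕ × ℕ → ℝ} {a : ℝ} :
    ConvergesTo x a ↔ Filter.Tendsto x lexAtTop (nhds a) := by
  simp only [ConvergesTo, Metric.tendsto_nhds, Real.dist_eq, eventually_lexAtTop_iff_before]

theorem lexLiminf_eq_top_iff {x : ℕ × ℕ → ℝ} :
    lexLiminf x = ⊤ ↔ ∀ B : ℝ, ∀ᶠ p in lexAtTop, B ≤ x p := by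
  simp only [eventually_lexAtTop_iff_before, lexLiminf]
  constructor
  · intro h B
    have hB : (B : EReal) < ⨆ q : ℕ × ℕ, ⨅ p : ℕ × ℕ, ⨅ _ : Before q p, (x p : EReal) := by
      rw [h]; exact EReal.coe_lt_top B
    obtain ⟨q, hq⟩ := lt_iSup_iff.1 hB
    exact ⟨q, fun p hp => EReal.coe_le_coe_iff.1 (hq.le.trans (iInf₂_le p hp))⟩
  · intro h
    rw [EReal.eq_top_iff_forall_lt]
    intro B
    obtain ⟨q, hq⟩ := h (B + 1)
    refine lt_of_lt_of_le (EReal.coe_lt_coe_iff.2 (lt_add_one B)) (le_iSup_of_le q ?_)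
    exact le_iInf₂ fun p hp => EReal.coe_le_coe_iff.2 (hq p hp)

/-- A nonnegative divergent family tends to infinity, or it crosses some rational interval
infinitely often. -/
theorem Diverges.eventually_or_crosses {x : ℕ × ℕ → ℝ} (h : Diverges x) (hx : ∀ p, 0 ≤ x p) :
    (∀ B : ℝ, ∀ᶠ p in lexAtTop, B ≤ x p) ∨
      ∃ a b : ℚ, a < b ∧ (∃ᶠ p in lexAtTop, x p < a) ∧ ∃ᶠ p in lexAtTop, (b : ℝ) < x p := by
  by_contra! hc
  obtain ⟨⟨B, hB⟩, hcross⟩ := hc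
  obtain ⟨c, hc⟩ := tendsto_of_no_upcrossings (f := lexAtTop) (u := fun p => (x p : EReal))
    EReal.denseRange_ratCast (by
      rintro _ ⟨a, rfl⟩ _ ⟨b, rfl⟩ hab ⟨h1, h2⟩
      have hab' : a < b := by
        have : ((a : ℝ) : EReal) < ((b : ℝ) : EReal) := hab
        exact_mod_cast this
      have hb := hcross a b hab' (h1.mono fun p hp => EReal.coe_lt_coe_iff.1 hp)
      exact h2 (hb.mono fun p hp => not_lt.2 (EReal.coe_le_coe_iff.2 hp)))
  induction c with
  | bot =>
    have h1 := hc.eventually_lt_const (EReal.bot_lt_coe 0)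
    have : lexAtTop = ⊥ := Filter.eventually_false_iff_eq_bot.1
      (h1.mono fun p hp => absurd (EReal.coe_lt_coe_iff.1 hp) (not_lt.2 (hx p)))
    rw [Filter.Frequently, this] at hB
    simp at hB
  | coe c => exact h ⟨c, convergesTo_iff_tendsto.2 (EReal.tendsto_coe.1 hc)⟩
  | top =>
    exact hB ((hc.eventually_const_lt (EReal.coe_lt_top B)).mono fun p hp =>
      not_lt.2 (EReal.coe_lt_coe_iff.1 hp).le)

theorem diverges_of_lexLiminf_eq_top {x : ℕ × ℕ → ℝ} (h : lexLiminf x = ⊤) : Diverges x := by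
  rintro ⟨a, ha⟩
  rw [convergesTo_iff_tendsto] at ha
  rw [lexLiminf_eq_top_iff] at h
  obtain ⟨k, hk⟩ := eventually_lexAtTop.1 ((ha.eventually_lt_const (lt_add_one a)).and (h (a + 1)))
  exact absurd (hk k 0 le_rfl).1 (not_lt.2 (hk k 0 le_rfl).2)

/-! ### Trading along a single path -/

/-- Induction along the lexicographic order, for a property that passes to the next row from every
late enough column of the current row. -/
theorem lex_induction {K : ℕ → ℕ} {Q : ℕ → ℕ → Prop} {m n m' n' : ℕ} (h0 : Q m n)
    (hs : ∀ m n, Q m n → Q m (n + 1)) (hr : ∀ m n, K m ≤ n → Q m n → Q (m + 1) 0)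
    (h : m < m' ∨ m = m' ∧ n ≤ n') : Q m' n' := by
  have row : ∀ {m n n'}, n ≤ n' → Q m n → Q m n' := by
    intro m n n' hn hq
    induction n', hn using Nat.le_induction with
    | base => exact hq
    | succ k _ ih => exact hs _ _ ih
  have next : ∀ {m n}, Q m n → Q (m + 1) 0 := fun {m n} hq =>
    hr m (max n (K m)) (le_max_right _ _) (row (le_max_left _ _) hq)
  rcases h with h | ⟨rfl, h⟩
  · refine row (Nat.zero_le _) ?_
    induction m', Nat.succ_le_of_lt h using Nat.le_induction with
    | base => exact next h0
    | succ k hk ih => exact next (ih (Nat.lt_of_succ_le hk))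
  · exact row h h0

/-- The gains at time `(m, n)` from holding one unit of an asset during those steps
`(i, j) → (i, j + 1)` for which `h i j` is true. The increments of the asset in row `i` are those
of `e i`, and only the first `K i` steps of a completed row count. -/
def transform (K : ℕ → ℕ) (h : ℕ → ℕ → Bool) (e : ℕ → ℕ → ℚ) (m n : ℕ) : ℚ :=
  (∑ i ∈ Finset.range m, ∑ j ∈ Finset.range (K i),
    if h i j = true then e i (j + 1) - e i j else 0) +
  ∑ j ∈ Finset.range n, if h m j = true then e m (j + 1) - e m j else 0

theorem transform_zero (K : ℕ → ℕ) (h : ℕ → ℕ → Bool) (e : ℕ → ℕ → ℚ) :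
    transform K h e 0 0 = 0 := by
  simp [transform]

theorem transform_succ (K : ℕ → ℕ) (h : ℕ → ℕ → Bool) (e : ℕ → ℕ → ℚ) (m n : ℕ) :
    transform K h e m (n + 1) =
      transform K h e m n + if h m n = true then e m (n + 1) - e m n else 0 := by
  rw [transform, transform, Finset.sum_range_succ, add_assoc]

theorem transform_row {K : ℕ → ℕ} (h : ℕ → ℕ → Bool) {e : ℕ → ℕ → ℚ}
    (he : ∀ m n, K m ≤ n → e m n = e m (K m)) {m n : ℕ} (hn : K m ≤ n) :
    transform K h e m n = transform K h e (m + 1) 0 := by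
  induction n, hn using Nat.le_induction with
  | base => simp [transform, Finset.sum_range_succ]
  | succ n hn ih => rw [transform_succ, ih, he m n hn, he m (n + 1) (by omega)]; simp

/-- The value of the asset, starting from `c`. -/
def price (K : ℕ → ℕ) (c : ℚ) (e : ℕ → ℕ → ℚ) (m n : ℕ) : ℚ :=
  c + transform K (fun _ _ => true) e m n

theorem price_eq (K : ℕ → ℕ) (c : ℚ) (e : ℕ → ℕ → ℚ) (m n : ℕ) :
    price K c e m n =
      c + ((∑ i ∈ Finset.range m, (e i (K i) - e i 0)) + (e m n - e m 0)) := by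
  simp only [price, transform, if_true, Finset.sum_range_sub]

/-- Whether the asset is held after a step that leads to the price `p`: it is bought below `a` and
sold above `b`. -/
def flagStep (a b : ℚ) (f : Bool) (p : ℚ) : Bool :=
  bif f then !decide (b < p) else decide (p < a)

theorem flagStep_of_lt {a b p : ℚ} (hab : a < b) (hp : p < a) (f : Bool) :
    flagStep a b f p = true := by
  cases f <;> simp [flagStep, hp, (hp.trans hab).le]

theorem flagStep_of_gt {a b p : ℚ} (hab : a < b) (hp : b < p) (f : Bool) :
    flagStep a b f p = false := by
  cases f <;> simp [flagStep, hp, (hab.trans hp).le]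

theorem flagStep_idem {a b : ℚ} (hab : a < b) (f : Bool) (p : ℚ) :
    flagStep a b (flagStep a b f p) p = flagStep a b f p := by
  rcases lt_or_ge p a with h | h
  · simp only [flagStep_of_lt hab h]
  rcases lt_or_ge b p with h' | h'
  · simp only [flagStep_of_gt hab h']
  cases f <;> simp [flagStep, h']

/-- The evolution of the holding flag along one row with prices `p`. -/
def rowFlag (a b : ℚ) (p : ℕ → ℚ) (f : Bool) (n : ℕ) : Bool :=
  Nat.rec f (fun j g => flagStep a b g (p (j + 1))) n

/-- The holding flag at the start of row `m`. -/
def startFlag (K : ℕ → ℕ) (a b : ℚ) (p : ℕ → ℕ → ℚ) (m : ℕ) : Bool :=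
  Nat.rec false (fun i g => rowFlag a b (p i) g (K i)) m

/-- Whether the asset is held at time `(m, n)` by the strategy that buys it whenever its price
is below `a` and sells it whenever its price is above `b`. -/
def flag (K : ℕ → ℕ) (a b : ℚ) (p : ℕ → ℕ → ℚ) (m n : ℕ) : Bool :=
  rowFlag a b (p m) (startFlag K a b p m) n

theorem flag_succ (K : ℕ → ℕ) (a b : ℚ) (p : ℕ → ℕ → ℚ) (m n : ℕ) :
    flag K a b p m (n + 1) = flagStep a b (flag K a b p m n) (p m (n + 1)) := rfl

theorem flag_zero_succ (K : ℕ → ℕ) (a b : ℚ) (p : ℕ → ℕ → ℚ) (m : ℕ) :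
    flag K a b p (m + 1) 0 = flag K a b p m (K m) := rfl

/-- The capital of the strategy `flag`, which trades one unit at a time and starts with `a`. -/
def capital (K : ℕ → ℕ) (a b c : ℚ) (e : ℕ → ℕ → ℚ) (m n : ℕ) : ℚ :=
  a + transform K (flag K a b (price K c e)) e m n

/-- A lower estimate of the gains that are safe: the capital less the current price while the asset
is held, and the capital less `a` otherwise. It never decreases, because the asset is bought only
at prices below `a`. -/
def potential (K : ℕ → ℕ) (a b c : ℚ) (e : ℕ → ℕ → ℚ) (m n : ℕ) : ℚ :=
  if flag K a b (price K c e) m n = true then capital K a b c e m n - price K c e m n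
  else capital K a b c e m n - a

section Path

variable {K : ℕ → ℕ} {a b c : ℚ} {e : ℕ → ℕ → ℚ}

theorem price_row (he : ∀ m n, K m ≤ n → e m n = e m (K m)) {m n : ℕ} (hn : K m ≤ n) :
    price K c e m n = price K c e (m + 1) 0 := by
  rw [price, price, transform_row _ he hn]

theorem capital_row (he : ∀ m n, K m ≤ n → e m n = e m (K m)) {m n : ℕ} (hn : K m ≤ n) :
    capital K a b c e m n = capital K a b c e (m + 1) 0 := by
  rw [capital, capital, transform_row _ he hn]

/-- The price is constant from column `K m` on, and repeating a step at the same price does not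
change the flag. Positivity of `K m` ensures that a step at this price has been made by
column `K m`. -/
theorem flag_row (hab : a < b) (hK : ∀ m, 0 < K m) (he : ∀ m n, K m ≤ n → e m n = e m (K m))
    {m n : ℕ} (hn : K m ≤ n) :
    flag K a b (price K c e) m n = flag K a b (price K c e) (m + 1) 0 := by
  induction n, hn using Nat.le_induction with
  | base => rfl
  | succ n hn ih =>
    rw [← ih]
    obtain ⟨k, rfl⟩ : ∃ k, n = k + 1 := ⟨n - 1, by have := hK m; omega⟩
    rw [flag_succ, price_row he (show K m ≤ k + 1 + 1 by omega), ← price_row he hn, flag_succ,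
      flagStep_idem hab]

theorem potential_row (hab : a < b) (hK : ∀ m, 0 < K m)
    (he : ∀ m n, K m ≤ n → e m n = e m (K m)) {m n : ℕ} (hn : K m ≤ n) :
    potential K a b c e m n = potential K a b c e (m + 1) 0 := by
  rw [potential, potential, flag_row hab hK he hn, capital_row he hn, price_row he hn]

theorem flag_of_price_lt (hab : a < b) (hK : ∀ m, 0 < K m)
    (he : ∀ m n, K m ≤ n → e m n = e m (K m)) {m n : ℕ} (hm : 0 < m)
    (h : price K c e m n < a) : flag K a b (price K c e) m n = true := by
  cases n with
  | succ n => rw [flag_succ, flagStep_of_lt hab h]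
  | zero =>
    obtain ⟨k, rfl⟩ : ∃ k, m = k + 1 := ⟨m - 1, by omega⟩
    rw [← price_row he le_rfl] at h
    rw [flag_zero_succ]
    obtain ⟨l, hl⟩ : ∃ l, K k = l + 1 := ⟨K k - 1, by have := hK k; omega⟩
    rw [hl] at h ⊢
    rw [flag_succ, flagStep_of_lt hab h]

theorem flag_of_lt_price (hab : a < b) (hK : ∀ m, 0 < K m)
    (he : ∀ m n, K m ≤ n → e m n = e m (K m)) {m n : ℕ} (hm : 0 < m)
    (h : b < price K c e m n) : flag K a b (price K c e) m n = false := by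
  cases n with
  | succ n => rw [flag_succ, flagStep_of_gt hab h]
  | zero =>
    obtain ⟨k, rfl⟩ : ∃ k, m = k + 1 := ⟨m - 1, by omega⟩
    rw [← price_row he le_rfl] at h
    rw [flag_zero_succ]
    obtain ⟨l, hl⟩ : ∃ l, K k = l + 1 := ⟨K k - 1, by have := hK k; omega⟩
    rw [hl] at h ⊢
    rw [flag_succ, flagStep_of_gt hab h]

/-- The potential never decreases, and a sale increases it by at least `b - a`. -/
theorem potential_step (hab : a < b) (m n : ℕ) :
    potential K a b c e m n ≤ potential K a b c e m (n + 1) ∧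
      (flag K a b (price K c e) m n = true → flag K a b (price K c e) m (n + 1) = false →
        potential K a b c e m n + (b - a) ≤ potential K a b c e m (n + 1)) := by
  have hp : price K c e m (n + 1) = price K c e m n + (e m (n + 1) - e m n) := by
    simp [price, transform_succ, add_assoc]
  have hC : capital K a b c e m (n + 1) = capital K a b c e m n +
      if flag K a b (price K c e) m n = true then e m (n + 1) - e m n else 0 := by
    rw [capital, capital, transform_succ, add_assoc]
  have hf := flag_succ K a b (price K c e) m n
  simp only [potential, hC, hf]
  rcases hfl : flag K a b (price K c e) m n with _ | _
  · by_cases hlt : price K c e m (n + 1) < a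
    · simp [flagStep, hlt]
      linarith
    · simp [flagStep, hlt]
  · by_cases hlt : b < price K c e m (n + 1)
    · simp [flagStep, hlt]
      constructor <;> linarith
    · simp [flagStep, hlt]
      linarith

theorem potential_mono (hab : a < b) (hK : ∀ m, 0 < K m)
    (he : ∀ m n, K m ≤ n → e m n = e m (K m)) {m n m' n' : ℕ} (h : m < m' ∨ m = m' ∧ n ≤ n') :
    potential K a b c e m n ≤ potential K a b c e m' n' :=
  lex_induction (K := K) (Q := fun m' n' => potential K a b c e m n ≤ potential K a b c e m' n')
    le_rfl (fun m' n' ih => ih.trans (potential_step hab m' n').1)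
    (fun _ _ hn ih => ih.trans_eq (potential_row hab hK he hn)) h

theorem potential_sale (hab : a < b) (hK : ∀ m, 0 < K m)
    (he : ∀ m n, K m ≤ n → e m n = e m (K m)) {m n m' n' : ℕ} (h : m < m' ∨ m = m' ∧ n ≤ n')
    (hf : flag K a b (price K c e) m n = true) (hf' : flag K a b (price K c e) m' n' = false) :
    potential K a b c e m n + (b - a) ≤ potential K a b c e m' n' := by
  -- once the flag has become false the gain is secured, and it stays so by monotonicity
  have := lex_induction (K := K) (Q := fun m' n' =>
    potential K a b c e m n ≤ potential K a b c e m' n' ∧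
      (flag K a b (price K c e) m' n' = false →
        potential K a b c e m n + (b - a) ≤ potential K a b c e m' n'))
    ⟨le_rfl, fun h => absurd h (by simp [hf])⟩ ?_ ?_ h
  · exact this.2 hf'
  · rintro m' n' ⟨h1, h2⟩
    obtain ⟨hs1, hs2⟩ := potential_step (K := K) (c := c) (e := e) hab m' n'
    refine ⟨h1.trans hs1, fun h => ?_⟩
    rcases hfl : flag K a b (price K c e) m' n' with _ | _
    · exact (h2 hfl).trans hs1
    · have := hs2 hfl h
      linarith
  · intro m' n' hn
    rw [potential_row hab hK he hn, flag_row hab hK he hn]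
    exact id

theorem potential_nonneg (hab : a < b) (hK : ∀ m, 0 < K m)
    (he : ∀ m n, K m ≤ n → e m n = e m (K m)) (m n : ℕ) : 0 ≤ potential K a b c e m n := by
  have h0 : potential K a b c e 0 0 = 0 := by
    simp [potential, capital, transform_zero, flag, rowFlag, startFlag]
  rw [← h0]
  refine potential_mono hab hK he ?_
  omega

theorem potential_le_capital (ha : 0 ≤ a) (hp : ∀ m n, 0 ≤ price K c e m n) (m n : ℕ) :
    potential K a b c e m n ≤ capital K a b c e m n := by
  have := hp m n
  rw [potential]
  split_ifs <;> linarith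

theorem capital_nonneg (hab : a < b) (hK : ∀ m, 0 < K m)
    (he : ∀ m n, K m ≤ n → e m n = e m (K m)) (ha : 0 ≤ a) (hp : ∀ m n, 0 ≤ price K c e m n)
    (m n : ℕ) : 0 ≤ capital K a b c e m n :=
  (potential_nonneg hab hK he m n).trans (potential_le_capital ha hp m n)

/-- If the price crosses the interval from `a` to `b` infinitely often, then the capital tends to
infinity. -/
theorem eventually_le_capital (hab : a < b) (hK : ∀ m, 0 < K m)
    (he : ∀ m n, K m ≤ n → e m n = e m (K m)) (ha : 0 ≤ a) (hp : ∀ m n, 0 ≤ price K c e m n)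
    (hlow : ∃ᶠ p in lexAtTop, price K c e p.1 p.2 < a)
    (hhigh : ∃ᶠ p in lexAtTop, b < price K c e p.1 p.2) (B : ℝ) :
    ∀ᶠ p in lexAtTop, B ≤ (capital K a b c e p.1 p.2 : ℝ) := by
  -- after `k` sales the safe gains are at least `k * (b - a)`
  have hsales : ∀ k : ℕ, ∃ m n, k * (b - a) ≤ potential K a b c e m n := by
    intro k
    induction k with
    | zero => exact ⟨0, 0, by simpa using potential_nonneg hab hK he 0 0⟩
    | succ k ih =>
      obtain ⟨m, n, hmn⟩ := ih
      obtain ⟨m₁, n₁, hm₁, h₁⟩ := frequently_lexAtTop hlow m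
      obtain ⟨m₂, n₂, hm₂, h₂⟩ := frequently_lexAtTop hhigh m₁
      refine ⟨m₂, n₂, ?_⟩
      have h3 := potential_mono (K := K) (a := a) (b := b) (c := c) (e := e) (n := n) (n' := n₁)
        hab hK he (Or.inl hm₁)
      have h4 := potential_sale hab hK he (Or.inl hm₂)
        (flag_of_price_lt hab hK he (by omega) h₁) (flag_of_lt_price hab hK he (by omega) h₂)
      push_cast
      linarith
  obtain ⟨k, hk⟩ := exists_nat_gt (B / ((b - a : ℚ) : ℝ))
  obtain ⟨m, n, hmn⟩ := hsales k
  refine eventually_lexAtTop.2 ⟨m + 1, fun m' n' hm' => ?_⟩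
  have h1 := potential_mono (K := K) (a := a) (b := b) (c := c) (e := e) (n := n) (n' := n')
    hab hK he (Or.inl (Nat.lt_of_succ_le hm'))
  have h2 := hmn.trans (h1.trans (potential_le_capital ha hp m' n'))
  have h3 : B ≤ k * ((b - a : ℚ) : ℝ) := by
    have hpos : (0 : ℝ) < ((b - a : ℚ) : ℝ) := by exact_mod_cast sub_pos.2 hab
    exact ((div_lt_iff₀ hpos).1 hk).le
  exact h3.trans (by exact_mod_cast h2)

end Path

/-! ### The price follows the given martingale -/

section Follow

variable {K : ℕ → ℕ} {c : ℚ} {e : ℕ → ℕ → ℚ} {x : ℕ → ℕ → ℝ}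

/-- The price differs from `x` by a constant, the errors of the row increments, and the error within
the current row. -/
theorem price_sub_eq (K : ℕ → ℕ) (c : ℚ) (e : ℕ → ℕ → ℚ) (x : ℕ → ℕ → ℝ) (m n : ℕ) :
    (price K c e m n : ℝ) = x m n + (c - x 0 0) +
      ((∑ i ∈ Finset.range m, (((e i (K i) : ℝ) - x (i + 1) 0) - (e i 0 - x i 0))) +
        ((e m n - x m n) - (e m 0 - x m 0))) := by
  have h := Finset.sum_range_sub (fun i => x i 0) m
  have h' : ∑ i ∈ Finset.range m, (((e i (K i) : ℝ) - x (i + 1) 0) - (e i 0 - x i 0)) =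
      ∑ i ∈ Finset.range m, ((e i (K i) : ℝ) - e i 0) -
        ∑ i ∈ Finset.range m, (x (i + 1) 0 - x i 0) := by
    rw [← Finset.sum_sub_distrib]
    exact Finset.sum_congr rfl fun i _ => by ring
  rw [price_eq, h', h]
  push_cast
  ring

theorem abs_sub_sub_le (h : ∀ m n, |(e m n : ℝ) - x m n| ≤ (1 / 2) ^ (m + 1))
    (m n : ℕ) {t : ℝ} (ht : |t| ≤ (1 / 2) ^ (m + 1)) : |t - (e m n - x m n)| ≤ (1 / 2) ^ m := by
  have h1 := abs_sub t ((e m n : ℝ) - x m n)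
  have h2 := h m n
  have h3 : ((1 : ℝ) / 2) ^ (m + 1) = (1 / 2) ^ m / 2 := by rw [pow_succ]; ring
  rw [h3] at h2 ht
  linarith

theorem price_ge (h : ∀ m n, |(e m n : ℝ) - x m n| ≤ (1 / 2) ^ (m + 1))
    (h' : ∀ m, |(e m (K m) : ℝ) - x (m + 1) 0| ≤ (1 / 2) ^ (m + 1)) (hc : x 0 0 + 2 ≤ c)
    (m n : ℕ) : x m n ≤ price K c e m n := by
  rw [price_sub_eq K c e x]
  have h1 : |∑ i ∈ Finset.range m, (((e i (K i) : ℝ) - x (i + 1) 0) - (e i 0 - x i 0))| ≤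
      ∑ i ∈ Finset.range m, ((1 : ℝ) / 2) ^ i :=
    (Finset.abs_sum_le_sum_abs _ _).trans
      (Finset.sum_le_sum fun i _ => abs_sub_sub_le h i 0 (h' i))
  have h2 := abs_sub_sub_le h m 0 (h m n)
  have h3 : (∑ i ∈ Finset.range m, ((1 : ℝ) / 2) ^ i) + (1 / 2) ^ m ≤ 2 := by
    rw [← Finset.sum_range_succ]
    exact sum_geometric_two_le _
  have h4 := (abs_le.1 h1).1
  have h5 := (abs_le.1 h2).1
  linarith

theorem Diverges.price (h : ∀ m n, |(e m n : ℝ) - x m n| ≤ (1 / 2) ^ (m + 1))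
    (h' : ∀ m, |(e m (K m) : ℝ) - x (m + 1) 0| ≤ (1 / 2) ^ (m + 1))
    (hx : Diverges fun p => x p.1 p.2) :
    Diverges fun p => (price K c e p.1 p.2 : ℝ) := by
  rintro ⟨l, hl⟩
  rw [convergesTo_iff_tendsto] at hl
  have hfst : Filter.Tendsto Prod.fst lexAtTop Filter.atTop := Filter.tendsto_comap
  have hsum : Summable fun i => ((e i (K i) : ℝ) - x (i + 1) 0) - (e i 0 - x i 0) :=
    Summable.of_norm_bounded summable_geometric_two fun i => abs_sub_sub_le h i 0 (h' i)
  have h1 := hsum.hasSum.tendsto_sum_nat.comp hfst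
  have h2 : Filter.Tendsto (fun p : ℕ × ℕ =>
      ((e p.1 p.2 : ℝ) - x p.1 p.2) - (e p.1 0 - x p.1 0)) lexAtTop (nhds 0) := by
    refine squeeze_zero_norm (fun p => abs_sub_sub_le h p.1 0 (h p.1 p.2)) ?_
    exact (tendsto_pow_atTop_nhds_zero_of_lt_one (r := (1 / 2 : ℝ)) (by norm_num)
      (by norm_num)).comp hfst
  refine hx ⟨_, convergesTo_iff_tendsto.2 (((hl.sub (h1.add h2)).sub_const (c - x 0 0)).congr ?_)⟩
  intro p
  rw [price_sub_eq K c e x]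
  simp only [Function.comp]
  ring

end Follow

/-! ### The uniform measure -/

instance isProbabilityMeasure_uniform : IsProbabilityMeasure uniform := by
  unfold uniform
  infer_instance

theorem fairCoin_singleton (b : Bool) : fairCoin {b} = 2⁻¹ := by
  simp [fairCoin]

theorem uniform_initialBits (ω : BitArray) (s : ℕ) :
    uniform {ξ | initialBits ξ s = initialBits ω s} = 2⁻¹ ^ s := by
  have h : {ξ | initialBits ξ s = initialBits ω s} =
      Set.pi ((Finset.range s).image Nat.unpair : Finset (ℕ × ℕ)) fun q => {ω q} := by
    ext ξ
    simp [initialBits_eq_iff]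
  have hinj : Function.Injective Nat.unpair := Nat.pairEquiv.symm.injective
  rw [h, uniform, Measure.infinitePi_pi _ (fun _ _ => measurableSet_singleton _),
    Finset.prod_image hinj.injOn]
  simp [fairCoin_singleton]

instance isOpenPosMeasure_uniform : uniform.IsOpenPosMeasure where
  open_pos U hU hne := by
    obtain ⟨ω, hω⟩ := hne
    obtain ⟨s, hs⟩ := exists_initialBits_subset hU hω
    refine fun h0 => absurd (measure_mono_null (fun ξ hξ => hs ξ hξ) h0 :
      uniform {ξ | initialBits ξ s = initialBits ω s} = 0) ?_
    rw [uniform_initialBits]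
    simp

theorem integrable_of_continuous {f : BitArray → ℝ} (hf : Continuous f) : Integrable f uniform :=
  hf.integrable_of_hasCompactSupport (HasCompactSupport.of_compactSpace f)

theorem integral_initialBits (F : List Bool → ℝ) (s : ℕ) :
    ∫ ξ, F (initialBits ξ s) ∂uniform =
      (∑ x ∈ Finset.range (2 ^ s), F (initialBits (ofNat x) s)) / 2 ^ s := by
  have hset : ∀ x, MeasurableSet {ξ | initialBits ξ s = initialBits (ofNat x) s} := fun x => by
    have := continuous_initialBits (fun σ => decide (σ = initialBits (ofNat x) s)) s
    have h := ((isOpen_discrete {true}).preimage this).measurableSet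
    convert h using 1
    ext ξ
    simp
  have hF : ∀ ξ, F (initialBits ξ s) = ∑ x ∈ Finset.range (2 ^ s),
      Set.indicator {ξ | initialBits ξ s = initialBits (ofNat x) s}
        (fun _ => F (initialBits (ofNat x) s)) ξ := by
    intro ξ
    obtain ⟨x, ⟨hx, hxξ⟩, huniq⟩ := existsUnique_initialBits_ofNat ξ s
    rw [Finset.sum_eq_single_of_mem x (Finset.mem_range.2 hx)]
    · simp [hxξ]
    · intro y hy hyx
      refine Set.indicator_of_notMem (fun h => hyx (huniq y ⟨Finset.mem_range.1 hy, ?_⟩)) _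
      exact Eq.symm h
  rw [integral_congr_ae (Filter.Eventually.of_forall hF),
    integral_finsetSum _ fun x _ => (integrable_const _).indicator (hset x), Finset.sum_div]
  refine Finset.sum_congr rfl fun x hx => ?_
  rw [integral_indicator_const _ (hset x), measureReal_def, uniform_initialBits, smul_eq_mul]
  simp [div_eq_inv_mul]

/-! ### Conditional expectations -/

/-- The array that agrees with `ω` on `S` and with `ξ` elsewhere. -/
noncomputable def glue (S : Set (ℕ × ℕ)) (ω ξ : BitArray) : BitArray :=
  open Classical in fun q => if q ∈ S then ω q else ξ q

theorem glue_of_mem {S : Set (ℕ × ℕ)} {q : ℕ × ℕ} (hq : q ∈ S) (ω ξ : BitArray) :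
    glue S ω ξ q = ω q := if_pos hq

theorem glue_of_notMem {S : Set (ℕ × ℕ)} {q : ℕ × ℕ} (hq : q ∉ S) (ω ξ : BitArray) :
    glue S ω ξ q = ξ q := if_neg hq

theorem continuous_glue (S : Set (ℕ × ℕ)) :
    Continuous fun x : BitArray × BitArray => glue S x.1 x.2 := by
  refine continuous_pi fun q => ?_
  by_cases hq : q ∈ S
  · simp only [glue_of_mem hq]; fun_prop
  · simp only [glue_of_notMem hq]; fun_prop

theorem continuous_concat (p : ℕ × ℕ) :
    Continuous fun x : BitArray × BitArray => concat p x.1 x.2 := by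
  refine continuous_pi fun q => ?_
  unfold concat
  split_ifs <;> fun_prop

theorem continuous_hide (S : Set (ℕ × ℕ)) : Continuous (hide S) := by
  refine continuous_pi fun q => ?_
  unfold hide
  split_ifs <;> fun_prop

/-- The law of an array whose bits on `S` are those of `ω` and whose other bits are independent fair
bits, selected without repetition from a random array `ξ`, does not depend on the selection. -/
theorem map_glue_comp {S : Set (ℕ × ℕ)} {ρ ρ' : ℕ × ℕ → ℕ × ℕ} (h : ∀ q ∉ S, ρ' (ρ q) = q)
    (ω : BitArray) :
    uniform.map (fun ξ => glue S ω fun q => ξ (ρ q)) = uniform.map fun ξ => glue S ω ξ := by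
  classical
  have hprob : ∀ q, IsProbabilityMeasure (if q ∈ S then Measure.dirac (ω q) else fairCoin) := by
    intro q
    split_ifs <;> infer_instance
  have key : ∀ ρ ρ' : ℕ × ℕ → ℕ × ℕ, (∀ q ∉ S, ρ' (ρ q) = q) →
      uniform.map (fun ξ => glue S ω fun q => ξ (ρ q)) =
        Measure.infinitePi fun q => if q ∈ S then Measure.dirac (ω q) else fairCoin := by
    intro ρ ρ' h
    refine Measure.eq_infinitePi _ fun I t ht => ?_
    have hmeas : Measurable fun ξ : BitArray => glue S ω fun q => ξ (ρ q) :=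
      ((continuous_glue S).comp (by fun_prop : Continuous fun ξ : BitArray =>
        ((ω, fun q => ξ (ρ q)) : BitArray × BitArray))).measurable
    rw [Measure.map_apply hmeas (MeasurableSet.pi I.countable_toSet fun i _ => ht i)]
    by_cases hω : ∀ q ∈ I, q ∈ S → ω q ∈ t q
    · have hpre : (fun ξ : BitArray => glue S ω fun q => ξ (ρ q)) ⁻¹' (Set.pi I t) =
          Set.pi ((I.filter (· ∉ S)).image ρ : Finset (ℕ × ℕ)) fun r => t (ρ' r) := by
        ext ξ
        simp only [Set.mem_preimage, Set.mem_pi, Finset.coe_image, Set.forall_mem_image,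
          Finset.mem_coe, Finset.mem_filter, and_imp]
        refine forall₂_congr fun q hq => ?_
        by_cases hqS : q ∈ S
        · simp [glue_of_mem hqS, hω q hq hqS, hqS]
        · simp [glue_of_notMem hqS, hqS, h q hqS]
      rw [hpre, uniform, Measure.infinitePi_pi _ fun _ _ => ht _, Finset.prod_image,
        Finset.prod_filter]
      · refine Finset.prod_congr rfl fun q hq => ?_
        by_cases hqS : q ∈ S
        · simp [hqS, Measure.dirac_apply' _ (ht q), hω q hq hqS]
        · simp [hqS, h q hqS]
      · intro q hq r hr hqr
        have hq' := (Finset.mem_filter.1 (Finset.mem_coe.1 hq)).2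
        have hr' := (Finset.mem_filter.1 (Finset.mem_coe.1 hr)).2
        rw [← h q hq', ← h r hr', hqr]
    · push Not at hω
      obtain ⟨q, hq, hqS, hωq⟩ := hω
      have hpre : (fun ξ : BitArray => glue S ω fun q => ξ (ρ q)) ⁻¹' (Set.pi I t) = ∅ := by
        refine Set.eq_empty_of_forall_notMem fun ξ hξ => hωq ?_
        simpa only [glue_of_mem hqS] using hξ q hq
      rw [hpre, measure_empty, Finset.prod_eq_zero hq]
      simp [hqS, Measure.dirac_apply' _ (ht q), hωq]
  rw [key ρ ρ' h, ← key id id fun _ _ => rfl]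
  rfl

theorem concat_eq_glue (p : ℕ × ℕ) (ω ξ : BitArray) :
    concat p ω ξ = glue (past p) ω fun q =>
      ξ (if q.1 = p.1 then (0, q.2 - p.2) else (q.1 - p.1, q.2)) := by
  funext q
  by_cases hq : Before q p
  · rw [glue_of_mem (S := past p) hq]
    simp [concat, hq]
  · rw [glue_of_notMem (S := past p) hq]
    simp only [concat, hq, if_false]
    split_ifs <;> rfl

/-- The conditional expectation resamples the bits that are not yet known. -/
theorem expect_eq_integral_glue {f : BitArray → ℝ} (hf : Continuous f) (p : ℕ × ℕ)
    (ω : BitArray) : expect p f ω = ∫ ξ, f (glue (past p) ω ξ) ∂uniform := by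
  have h := map_glue_comp (S := past p)
    (ρ := fun q => if q.1 = p.1 then (0, q.2 - p.2) else (q.1 - p.1, q.2))
    (ρ' := fun r => if r.1 = 0 then (p.1, r.2 + p.2) else (r.1 + p.1, r.2)) (by
      intro q hq
      have hq' : ¬ (q.1 < p.1 ∨ (q.1 = p.1 ∧ q.2 < p.2)) := hq
      by_cases h : q.1 = p.1
      · simp only [h, if_true]
        refine Prod.ext h.symm ?_
        simp only
        omega
      · have h1 : q.1 - p.1 ≠ 0 := by omega
        simp only [h, if_false, h1]
        refine Prod.ext ?_ rfl
        simp only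
        omega) ω
  have hg : Continuous fun ξ => glue (past p) ω ξ :=
    (continuous_glue _).comp (Continuous.prodMk_right ω)
  have hc : Continuous fun ξ => concat p ω ξ :=
    (continuous_concat _).comp (Continuous.prodMk_right ω)
  simp only [← concat_eq_glue] at h
  rw [expect, ← integral_map hg.aemeasurable hf.aestronglyMeasurable, ← h,
    integral_map hc.aemeasurable hf.aestronglyMeasurable]

/-- Replacing part of the bits of a random array by those of an independent one does not change
its law. -/
theorem measurePreserving_glue (S : Set (ℕ × ℕ)) :
    MeasurePreserving (fun x : BitArray × BitArray => glue S x.1 x.2)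
      (uniform.prod uniform) uniform := by
  classical
  refine ⟨(continuous_glue S).measurable, ?_⟩
  refine Measure.eq_infinitePi _ fun I t ht => ?_
  rw [Measure.map_apply (continuous_glue S).measurable
    (MeasurableSet.pi I.countable_toSet fun i _ => ht i)]
  have hpre : (fun x : BitArray × BitArray => glue S x.1 x.2) ⁻¹' (Set.pi I t) =
      (Set.pi (I.filter (· ∈ S) : Finset (ℕ × ℕ)) t) ×ˢ
        (Set.pi (I.filter (¬ · ∈ S) : Finset (ℕ × ℕ)) t) := by
    ext ⟨ω, ξ⟩
    simp only [Set.mem_preimage, Set.mem_pi, Set.mem_prod, Finset.mem_coe, Finset.mem_filter,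
      and_imp, ← forall₂_and]
    refine forall₂_congr fun q hq => ?_
    by_cases hqS : q ∈ S
    · simp [glue_of_mem hqS, hqS]
    · simp [glue_of_notMem hqS, hqS]
  rw [hpre, Measure.prod_prod, uniform, Measure.infinitePi_pi _ fun _ _ => ht _,
    Measure.infinitePi_pi _ fun _ _ => ht _, Finset.prod_filter_mul_prod_filter_not]

theorem continuous_expect {f : BitArray → ℝ} (hf : Continuous f) (p : ℕ × ℕ) :
    Continuous (expect p f) := by
  obtain ⟨C, hC⟩ := isCompact_univ.exists_bound_of_continuousOn hf.continuousOn
  refine continuous_of_dominated (bound := fun _ => C) (fun ω => ?_) (fun ω => ?_)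
    (integrable_const C) ?_
  · exact (hf.comp ((continuous_concat p).comp
      (Continuous.prodMk_right ω))).aestronglyMeasurable
  · exact Filter.Eventually.of_forall fun ξ => hC _ (Set.mem_univ _)
  · exact Filter.Eventually.of_forall fun ξ => hf.comp ((continuous_concat p).comp
      (Continuous.prodMk_left ξ))

theorem eqOn_concat (p : ℕ × ℕ) (ω ξ : BitArray) : Set.EqOn (concat p ω ξ) ω (past p) := by
  intro q hq
  have hq' : Before q p := hq
  simp [concat, hq']

theorem expect_congr {p : ℕ × ℕ} {ω ω' : BitArray} (h : Set.EqOn ω ω' (past p))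
    (f : BitArray → ℝ) : expect p f ω = expect p f ω' := by
  have : ∀ ξ, concat p ω ξ = concat p ω' ξ := fun ξ => by
    funext q
    by_cases hq : Before q p
    · simp [concat, hq, h hq]
    · simp [concat, hq]
  simp only [expect, this]

theorem expect_of_eqOn {p : ℕ × ℕ} {f : BitArray → ℝ}
    (h : ∀ ω ω', Set.EqOn ω ω' (past p) → f ω = f ω') (ω : BitArray) : expect p f ω = f ω := by
  simp [expect, fun ξ => h _ _ (eqOn_concat p ω ξ)]

theorem past_subset {p q : ℕ × ℕ} (h : Before q p ∨ q = p) : past q ⊆ past p := by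
  rcases h with h | rfl
  · intro r hr
    simp only [past, Before, Set.mem_ofPred_eq] at h hr ⊢
    omega
  · exact subset_rfl

/-- The tower property. -/
theorem expect_expect {f : BitArray → ℝ} (hf : Continuous f) {q p : ℕ × ℕ}
    (hqp : Before q p ∨ q = p) (ω : BitArray) : expect q (expect p f) ω = expect q f ω := by
  have hsub := past_subset hqp
  have hglue : ∀ ξ η,
      glue (past p) (glue (past q) ω ξ) η = glue (past q) ω (glue (past p) ξ η) := by
    intro ξ η
    funext r
    by_cases hr : r ∈ past p
    · by_cases hr' : r ∈ past q <;> simp [glue, hr, hr']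
    · have hr' : r ∉ past q := fun h => hr (hsub h)
      simp [glue, hr, hr']
  have hc : Continuous fun ζ => f (glue (past q) ω ζ) :=
    hf.comp ((continuous_glue _).comp (Continuous.prodMk_right ω))
  have hmp := measurePreserving_glue (past p)
  rw [expect_eq_integral_glue (continuous_expect hf p), expect_eq_integral_glue hf]
  simp only [expect_eq_integral_glue hf p, hglue]
  rw [← integral_prod (fun x : BitArray × BitArray =>
    f (glue (past q) ω (glue (past p) x.1 x.2)))
    (hmp.integrable_comp_of_integrable (integrable_of_continuous hc))]
  have h := integral_map (μ := uniform.prod uniform) hmp.measurable.aemeasurable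
    hc.aestronglyMeasurable
  rw [hmp.map_eq] at h
  exact h.symm

/-- The conditional expectation of a function of finitely many bits is a finite average. -/
theorem expect_initialBits (p : ℕ × ℕ) (F : List Bool → ℝ) (s : ℕ) (ω : BitArray) :
    expect p (fun ξ => F (initialBits ξ s)) ω =
      (∑ x ∈ Finset.range (2 ^ s), F (initialBits (glue (past p) ω (ofNat x)) s)) / 2 ^ s := by
  rw [expect_eq_integral_glue (continuous_initialBits F s)]
  have h : ∀ ξ, initialBits (glue (past p) ω ξ) s =
      initialBits (glue (past p) ω (ofList (initialBits ξ s))) s := by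
    intro ξ
    rw [initialBits_eq_iff]
    intro i hi
    have := initialBits_eq_iff.1 (initialBits_ofList_initialBits ξ (le_refl s)) i hi
    simp [glue, this]
  rw [integral_congr_ae (Filter.Eventually.of_forall fun ξ => congrArg F (h ξ)),
    integral_initialBits (fun σ => F (initialBits (glue (past p) ω (ofList σ)) s))]
  simp only [← h]

/-! ### Computability of the trading strategy -/

section Strategy

variable {α : Type} [Primcodable α] {K : ℕ → ℕ}

theorem IsRatComputable.transform (hK : Computable K) {h : α → ℕ → ℕ → Bool}
    {e : α → ℕ → ℕ → ℚ} (hh : Computable fun y : α × ℕ × ℕ => h y.1 y.2.1 y.2.2)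
    (he : IsRatComputable fun y : α × ℕ × ℕ => e y.1 y.2.1 y.2.2) :
    IsRatComputable fun y : α × ℕ × ℕ => transform K (h y.1) (e y.1) y.2.1 y.2.2 := by
  have hnext : Computable fun y : α × ℕ × ℕ => (y.1, y.2.1, y.2.2 + 1) :=
    Computable.pair Computable.fst (Computable.pair (Computable.fst.comp Computable.snd)
      (Computable.succ.comp (Computable.snd.comp Computable.snd)))
  have hd := IsRatComputable.cond hh ((he.comp hnext).sub he) (IsRatComputable.const 0)
  have hcol : Computable fun z : (α × ℕ × ℕ) × ℕ => (z.1.1, z.1.2.1, z.2) :=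
    Computable.pair (Computable.fst.comp Computable.fst) (Computable.pair
      (Computable.fst.comp (Computable.snd.comp Computable.fst)) Computable.snd)
  have hrow := (hd.comp hcol).sum (f := fun (y : α × ℕ × ℕ) j =>
    if h y.1 y.2.1 j = true then e y.1 y.2.1 (j + 1) - e y.1 y.2.1 j else 0)
    (Computable.snd.comp Computable.snd)
  have hfull : Computable fun z : (α × ℕ × ℕ) × ℕ => (z.1.1, z.2, K z.2) :=
    Computable.pair (Computable.fst.comp Computable.fst) (Computable.pair
      Computable.snd (hK.comp Computable.snd))
  have hrows := (hrow.comp hfull).sum (f := fun (y : α × ℕ × ℕ) i =>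
    ∑ j ∈ Finset.range (K i), if h y.1 i j = true then e y.1 i (j + 1) - e y.1 i j else 0)
    (Computable.fst.comp Computable.snd)
  exact hrows.add hrow

theorem computable_flag (hK : Computable K) (a b : ℚ) {p : α → ℕ → ℕ → ℚ}
    (hp : IsRatComputable fun y : α × ℕ × ℕ => p y.1 y.2.1 y.2.2) :
    Computable fun y : α × ℕ × ℕ => flag K a b (p y.1) y.2.1 y.2.2 := by
  have hrow : Computable fun z : (α × ℕ) × Bool × ℕ =>
      rowFlag a b (p z.1.1 z.1.2) z.2.1 z.2.2 := by
    have hat : Computable fun w : ((α × ℕ) × Bool × ℕ) × ℕ × Bool =>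
        (w.1.1.1, w.1.1.2, w.2.1 + 1) :=
      Computable.pair (Computable.fst.comp (Computable.fst.comp Computable.fst))
        (Computable.pair (Computable.snd.comp (Computable.fst.comp Computable.fst))
          (Computable.succ.comp (Computable.fst.comp Computable.snd)))
    have hp' := hp.comp hat
    have hsell := (IsRatComputable.const b).decide_lt hp'
    have hbuy := hp'.decide_lt (IsRatComputable.const a)
    have hstep := Computable.cond
      (Computable.snd.comp (Computable.snd (α := (α × ℕ) × Bool × ℕ) (β := ℕ × Bool)))
      (Primrec.not.to_comp.comp hsell) hbuy
    have hrec := Computable.nat_rec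
      (Computable.snd.comp (Computable.snd (α := α × ℕ) (β := Bool × ℕ)))
      (Computable.fst.comp Computable.snd) hstep.to₂
    exact hrec
  have hstart : Computable fun z : α × ℕ => startFlag K a b (p z.1) z.2 := by
    have harg : Computable fun w : (α × ℕ) × ℕ × Bool =>
        ((w.1.1, w.2.1), (w.2.2, K w.2.1)) :=
      Computable.pair (Computable.pair (Computable.fst.comp Computable.fst)
        (Computable.fst.comp Computable.snd)) (Computable.pair
          (Computable.snd.comp Computable.snd)
          (hK.comp (Computable.fst.comp Computable.snd)))
    have hstep := hrow.comp harg
    have hrec := Computable.nat_rec (Computable.snd (α := α) (β := ℕ)) (Computable.const false)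
      hstep.to₂
    exact hrec
  have hpos : Computable fun y : α × ℕ × ℕ => (y.1, y.2.1) :=
    Computable.pair Computable.fst (Computable.fst.comp Computable.snd)
  have hs := hstart.comp hpos
  have harg := Computable.pair hpos
    (Computable.pair hs (Computable.snd.comp (Computable.snd (α := α) (β := ℕ × ℕ))))
  have := hrow.comp harg
  exact this

end Strategy

theorem transform_congr {K : ℕ → ℕ} {h h' : ℕ → ℕ → Bool} {e e' : ℕ → ℕ → ℚ} {m n : ℕ}
    (hh : ∀ i j, i < m ∨ i = m ∧ j < n → h i j = h' i j)
    (he : ∀ i j, i < m ∨ i = m ∧ j ≤ n → e i j = e' i j) :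
    transform K h e m n = transform K h' e' m n := by
  rw [transform, transform]
  congr 1
  · refine Finset.sum_congr rfl fun i hi => Finset.sum_congr rfl fun j _ => ?_
    have := Finset.mem_range.1 hi
    rw [hh i j (by omega), he i j (by omega), he i (j + 1) (by omega)]
  · refine Finset.sum_congr rfl fun j hj => ?_
    have := Finset.mem_range.1 hj
    rw [hh m j (by omega), he m j (by omega), he m (j + 1) (by omega)]

theorem price_congr {K : ℕ → ℕ} {c : ℚ} {e e' : ℕ → ℕ → ℚ} {m n : ℕ}
    (he : ∀ i j, i < m ∨ i = m ∧ j ≤ n → e i j = e' i j) :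
    price K c e m n = price K c e' m n := by
  rw [price, price, transform_congr (fun _ _ _ => rfl) he]

theorem rowFlag_congr {a b : ℚ} {p p' : ℕ → ℚ} {n : ℕ} (hp : ∀ j ≤ n, p j = p' j) (f : Bool) :
    rowFlag a b p f n = rowFlag a b p' f n := by
  induction n with
  | zero => rfl
  | succ n ih =>
    have h1 := ih fun j hj => hp j (by omega)
    simp only [rowFlag] at h1 ⊢
    rw [h1, hp (n + 1) le_rfl]

theorem flag_congr {K : ℕ → ℕ} {a b : ℚ} {p p' : ℕ → ℕ → ℚ} {m n : ℕ}
    (hp : ∀ i j, i < m ∨ i = m ∧ j ≤ n → p i j = p' i j) :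
    flag K a b p m n = flag K a b p' m n := by
  have hstart : ∀ k ≤ m, startFlag K a b p k = startFlag K a b p' k := by
    intro k hk
    induction k with
    | zero => rfl
    | succ k ih =>
      have h1 := ih (by omega)
      simp only [startFlag] at h1 ⊢
      rw [h1, rowFlag_congr fun j _ => hp k j (by omega)]
  rw [flag, flag, hstart m le_rfl, rowFlag_congr fun j hj => hp m j (by omega)]

/-! ### Approximation by functions of finitely many bits -/

theorem IsCauchyName.abs_sub_le {f : ℕ → ℕ} {x : ℝ} (h : IsCauchyName f x) (i : ℕ) :
    |(ratEnum (f i) : ℝ) - x| ≤ (1 / 2) ^ i := by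
  rw [abs_sub_comm, one_div]
  exact le_of_tendsto ((h.2.sub_const _).abs)
    (Filter.eventually_atTop.2 ⟨i, fun j hj => h.1 i j hj⟩)

theorem continuous_of_computablyAdapted {ι : Type} [Primcodable ι] {S : ι → Set (ℕ × ℕ)}
    {M : ι → BitArray → ℝ} (h : ComputablyAdapted S M) (t : ι) : Continuous (M t) := by
  obtain ⟨g, hg, hM⟩ := h
  obtain ⟨s, -, V, -, hV⟩ := hg.exists_use
  have hunif : TendstoUniformly (fun j ω => (ratEnum (g (t, j) (hide (S t) ω)) : ℝ)) (M t)
      Filter.atTop := by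
    rw [Metric.tendstoUniformly_iff]
    intro ε hε
    have := (tendsto_pow_atTop_nhds_zero_of_lt_one (r := (1 / 2 : ℝ)) (by norm_num)
      (by norm_num)).eventually_lt_const hε
    filter_upwards [this] with j hj ω
    rw [dist_comm, Real.dist_eq]
    exact ((hM t ω).abs_sub_le j).trans_lt hj
  refine hunif.continuous (Filter.Eventually.of_forall fun j => ?_).frequently
  simp only [hV]
  exact (continuous_initialBits (fun σ => (ratEnum (V (t, j) σ) : ℝ)) _).comp
    (continuous_hide (S t))

theorem initialBits_hide {ω ξ : BitArray} {s : ℕ} (S : Set (ℕ × ℕ))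
    (h : initialBits ω s = initialBits ξ s) :
    initialBits (hide S ω) s = initialBits (hide S ξ) s := by
  rw [initialBits_eq_iff] at h ⊢
  intro i hi
  simp [hide, h i hi]

theorem initialBits_glue {ω ξ : BitArray} {s : ℕ} (S : Set (ℕ × ℕ)) (ζ : BitArray)
    (h : initialBits ω s = initialBits ξ s) :
    initialBits (glue S ω ζ) s = initialBits (glue S ξ ζ) s := by
  rw [initialBits_eq_iff] at h ⊢
  intro i hi
  simp [glue, h i hi]

theorem eqOn_hide (S : Set (ℕ × ℕ)) (ω : BitArray) : Set.EqOn (hide S ω) ω S := by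
  intro q hq
  simp [hide, hq]

section Approximation

variable (s : ℕ → ℕ) (V : ℕ → List Bool → ℕ)

/-- The rational number with index `V m σ`, where `σ` consists of the first `s m` bits of the array
with all rows after row `m` hidden. It serves as an approximation of a random variable that depends
on the rows `0, …, m`. -/
noncomputable def approx (m : ℕ) (ω : BitArray) : ℚ :=
  ratEnum (V m (initialBits (hide (rowPast (m + 1)) ω) (s m)))

/-- The conditional expectation of `approx s V m` at time `(m, n)`, as a finite average. -/
noncomputable def condApprox (ω : BitArray) (m n : ℕ) : ℚ :=
  (∑ x ∈ Finset.range (2 ^ s m), approx s V m (glue (past (m, n)) ω (ofNat x))) / 2 ^ s m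

variable {s V}

theorem approx_congr {m : ℕ} {ω ω' : BitArray} (h : initialBits ω (s m) = initialBits ω' (s m)) :
    approx s V m ω = approx s V m ω' := by
  rw [approx, approx, initialBits_hide _ h]

theorem continuous_approx (m : ℕ) : Continuous fun ω => (approx s V m ω : ℝ) := by
  refine (continuous_initialBits (fun σ => (approx s V m (ofList σ) : ℝ)) (s m)).congr fun ω => ?_
  rw [approx_congr (initialBits_ofList_initialBits ω le_rfl)]

theorem condApprox_eq_expect (ω : BitArray) (m n : ℕ) :
    (condApprox s V ω m n : ℝ) = expect (m, n) (fun ξ => (approx s V m ξ : ℝ)) ω := by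
  have h := expect_initialBits (m, n) (fun σ => (approx s V m (ofList σ) : ℝ)) (s m) ω
  have h' : ∀ ξ, approx s V m (ofList (initialBits ξ (s m))) = approx s V m ξ := fun ξ =>
    approx_congr (initialBits_ofList_initialBits ξ le_rfl)
  simp only [h'] at h
  rw [h, condApprox]
  push_cast
  rfl

theorem condApprox_congr_past {ω ω' : BitArray} {m n : ℕ} (h : Set.EqOn ω ω' (past (m, n))) :
    condApprox s V ω m n = condApprox s V ω' m n := by
  have : ∀ ξ, glue (past (m, n)) ω ξ = glue (past (m, n)) ω' ξ := fun ξ => by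
    funext q
    by_cases hq : q ∈ past (m, n)
    · simp [glue, hq, h hq]
    · simp [glue, hq]
  simp only [condApprox, this]

theorem condApprox_congr_bits {ω ω' : BitArray} {m : ℕ}
    (h : initialBits ω (s m) = initialBits ω' (s m)) (n : ℕ) :
    condApprox s V ω m n = condApprox s V ω' m n := by
  simp only [condApprox]
  refine congrArg (· / _) (Finset.sum_congr rfl fun x _ => ?_)
  exact approx_congr (initialBits_glue _ _ h)

/-- The bits read by `approx s V m` are all known in column `s m` of row `m`. -/
theorem condApprox_eq_approx (ω : BitArray) {m n : ℕ} (hn : s m ≤ n) :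
    condApprox s V ω m n = approx s V m ω := by
  have h : (condApprox s V ω m n : ℝ) = approx s V m ω := by
    rw [condApprox_eq_expect, expect_of_eqOn]
    intro ξ ξ' h
    have hbits : initialBits (hide (rowPast (m + 1)) ξ) (s m) =
        initialBits (hide (rowPast (m + 1)) ξ') (s m) := ?_
    · rw [approx, approx, hbits]
    rw [initialBits_eq_iff]
    intro i hi
    by_cases hrow : Nat.unpair i ∈ rowPast (m + 1)
    · have hmem : Nat.unpair i ∈ past (m, n) := by
        have h1 : (Nat.unpair i).1 < m + 1 := hrow
        have h2 := Nat.unpair_right_le i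
        simp only [past, Before, Set.mem_ofPred_eq]
        omega
      simp [hide, hrow, h hmem]
    · simp [hide, hrow]
  exact_mod_cast h

theorem expect_condApprox (ω : BitArray) (m n : ℕ) :
    expect (m, n) (fun ξ => (condApprox s V ξ m (n + 1) : ℝ)) ω = condApprox s V ω m n := by
  have h : (fun ξ => (condApprox s V ξ m (n + 1) : ℝ)) =
      expect (m, n + 1) (fun ξ => (approx s V m ξ : ℝ)) :=
    funext fun ξ => condApprox_eq_expect ξ m (n + 1)
  rw [h, expect_expect (q := (m, n)) (p := (m, n + 1)) (continuous_approx m)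
    (Or.inl (Or.inr ⟨rfl, Nat.lt_succ_self n⟩)),
    condApprox_eq_expect]

theorem continuous_condApprox (m n : ℕ) : Continuous fun ω => (condApprox s V ω m n : ℝ) := by
  have h := continuous_expect (continuous_approx (s := s) (V := V) m) (m, n)
  exact h.congr fun ω => (condApprox_eq_expect ω m n).symm

theorem hide_glue_apply (m : ℕ) (p : ℕ × ℕ) (ω ξ : BitArray) (q : ℕ × ℕ) :
    hide (rowPast (m + 1)) (glue (past p) ω ξ) q =
      bif decide (q.1 < m.succ) then bif decide (Before q p) then ω q else ξ q else false := by
  by_cases h1 : q.1 < m.succ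
  · rw [hide, if_pos (show q ∈ rowPast (m + 1) from h1), decide_eq_true h1, cond_true]
    by_cases h2 : Before q p
    · rw [glue_of_mem (show q ∈ past p from h2), decide_eq_true h2, cond_true]
    · rw [glue_of_notMem (show q ∉ past p from h2), decide_eq_false h2, cond_false]
  · rw [hide, if_neg (show q ∉ rowPast (m + 1) from h1), decide_eq_false h1, cond_false]

theorem computable_initialBits_hide_glue : Computable
    fun z : ((List Bool × ℕ × ℕ) × ℕ) × ℕ => initialBits
      (hide (rowPast (z.1.1.2.1 + 1))
        (glue (past z.1.1.2) (ofList z.1.1.1) (ofNat z.1.2))) z.2 := by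
  have hrow : Primrec fun w : (((List Bool × ℕ × ℕ) × ℕ) × ℕ) × ℕ => (Nat.unpair w.2).1 :=
    Primrec.fst.comp (Primrec.unpair.comp Primrec.snd)
  have hcol : Primrec fun w : (((List Bool × ℕ × ℕ) × ℕ) × ℕ) × ℕ => (Nat.unpair w.2).2 :=
    Primrec.snd.comp (Primrec.unpair.comp Primrec.snd)
  have hy : Primrec fun w : (((List Bool × ℕ × ℕ) × ℕ) × ℕ) × ℕ => w.1.1.1 :=
    Primrec.fst.comp (Primrec.fst.comp Primrec.fst)
  have hm := Primrec.fst.comp (Primrec.snd.comp hy)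
  have hn := Primrec.snd.comp (Primrec.snd.comp hy)
  have hbefore := Primrec.or.comp (Primrec.nat_lt.decide.comp hrow hm)
    (Primrec.and.comp (Primrec.eq.decide.comp hrow hm) (Primrec.nat_lt.decide.comp hcol hn))
  have hbefore' : Primrec fun w : (((List Bool × ℕ × ℕ) × ℕ) × ℕ) × ℕ =>
      decide (Before (Nat.unpair w.2) w.1.1.1.2) :=
    hbefore.of_eq fun w => by
      rw [Bool.eq_iff_iff, decide_eq_true_iff]
      simp only [Bool.or_eq_true, Bool.and_eq_true, decide_eq_true_iff]
      rfl
  have hold := (Primrec.list_getD false).comp (Primrec.fst.comp hy) Primrec.snd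
  have hnew := primrec_testBit.comp
    (Primrec.snd.comp (Primrec.fst.comp (Primrec.fst (α := ((List Bool × ℕ × ℕ) × ℕ) × ℕ)
      (β := ℕ)))) Primrec.snd
  have hbit := Primrec.cond (Primrec.nat_lt.decide.comp hrow (Primrec.succ.comp hm))
    (Primrec.cond hbefore' hold hnew) (Primrec.const false)
  have hlist := Primrec.list_map (Primrec.list_range.comp
    (Primrec.snd (α := (List Bool × ℕ × ℕ) × ℕ) (β := ℕ))) hbit.to₂
  refine hlist.to_comp.of_eq fun z => ?_
  simp only [initialBits]
  refine List.map_congr_left fun i _ => ?_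
  rw [hide_glue_apply, ofNat_unpair, ofList_unpair]

theorem isRatComputable_condApprox (hs : Computable s) (hV : Computable₂ V) :
    IsRatComputable fun y : List Bool × ℕ × ℕ => condApprox s V (ofList y.1) y.2.1 y.2.2 := by
  have hm : Computable fun y : List Bool × ℕ × ℕ => y.2.1 := Computable.fst.comp Computable.snd
  have hsm := hs.comp hm
  have hbits := computable_initialBits_hide_glue.comp
    (Computable.pair (Computable.id (α := (List Bool × ℕ × ℕ) × ℕ)) (hsm.comp Computable.fst))
  have hterm := IsRatComputable.ratEnum_comp (hV.comp (hm.comp Computable.fst) hbits)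
  have hsum := hterm.sum (f := fun (y : List Bool × ℕ × ℕ) x =>
      approx s V y.2.1 (glue (past y.2) (ofList y.1) (ofNat x)))
    (primrec_two_pow.to_comp.comp hsm)
  exact hsum.div_two_pow hsm

end Approximation

/-! ### Martingale transforms of the approximating process -/

section Transform

variable {s : ℕ → ℕ} {V : ℕ → List Bool → ℕ} {h : BitArray → ℕ → ℕ → Bool} {c : ℚ}

theorem condApprox_row (ω : BitArray) (m n : ℕ) (hn : s m + 1 ≤ n) :
    condApprox s V ω m n = condApprox s V ω m (s m + 1) := by
  rw [condApprox_eq_approx ω (by omega), condApprox_eq_approx ω (by omega)]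

/-- A transform of the approximating process by a computable strategy whose position at each time
is determined by the past and by a computable number of bits. -/
theorem isComputableRationalMartingale_transform (hs : Computable s) (hV : Computable₂ V)
    (hpast : ∀ {ω ω' m n}, Set.EqOn ω ω' (past (m, n)) → h ω m n = h ω' m n)
    (hbits : ∀ {ω ω' m}, (∀ i ≤ m, initialBits ω (s i) = initialBits ω' (s i)) →
      ∀ n, h ω m n = h ω' m n)
    (hcomp : Computable fun y : List Bool × ℕ × ℕ => h (ofList y.1) y.2.1 y.2.2) :
    IsComputableRationalMartingale fun p ω =>
      ((c + transform (fun m => s m + 1) (h ω) (condApprox s V ω) p.1 p.2 : ℚ) : ℝ) := by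
  let X : ℕ × ℕ → BitArray → ℚ := fun p ω =>
    c + transform (fun m => s m + 1) (h ω) (condApprox s V ω) p.1 p.2
  -- the value at a time in row `m` depends on the first `T m` bits only
  let T : ℕ → ℕ := fun m => (Finset.range (m + 1)).sup s
  have hT : ∀ {i m}, i ≤ m → s i ≤ T m := fun {i m} him =>
    Finset.le_sup (f := s) (Finset.mem_range.2 (Nat.lt_succ_of_le him))
  have hXpast : ∀ {p ω ω'}, Set.EqOn ω ω' (past p) → X p ω = X p ω' := by
    intro p ω ω' hω
    have hsub : ∀ {i j}, i < p.1 ∨ i = p.1 ∧ j ≤ p.2 → Set.EqOn ω ω' (past (i, j)) := by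
      intro i j hij
      refine hω.mono (past_subset ?_)
      rcases hij with hij | ⟨rfl, hij⟩
      · exact Or.inl (Or.inl hij)
      · rcases hij.lt_or_eq with hij | rfl
        · exact Or.inl (Or.inr ⟨rfl, hij⟩)
        · exact Or.inr rfl
    exact congrArg (c + ·) (transform_congr (fun i j hij => hpast (hsub (by omega)))
      fun i j hij => condApprox_congr_past (hsub hij))
  have hXbits : ∀ {p ω ω'}, initialBits ω (T p.1) = initialBits ω' (T p.1) → X p ω = X p ω' := by
    intro p ω ω' hω
    have hsub : ∀ {i}, i ≤ p.1 → initialBits ω (s i) = initialBits ω' (s i) := fun hi =>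
      initialBits_eq_mono (hT hi) hω
    refine congrArg (c + ·) (transform_congr (fun i j hij => hbits (fun k hk => hsub (by omega)) j)
      fun i j hij => condApprox_congr_bits (hsub (by omega)) j)
  have hXlist : ∀ p ω, X p (ofList (initialBits ω (T p.1))) = X p ω := fun p ω =>
    hXbits (initialBits_ofList_initialBits ω le_rfl)
  have hXcont : ∀ p, Continuous fun ω => (X p ω : ℝ) := fun p =>
    (continuous_initialBits (fun σ => (X p (ofList σ) : ℝ)) (T p.1)).congr fun ω => by
      rw [hXlist]
  -- one step of the martingale property: the increment is the position times a martingale increment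
  have hstep : ∀ m n ω, expect (m, n) (fun ξ => (X (m, n + 1) ξ : ℝ)) ω = X (m, n) ω := by
    intro m n ω
    have hX : ∀ ξ, (X (m, n + 1) ξ : ℝ) = X (m, n) ξ + if h ξ m n = true then
        (condApprox s V ξ m (n + 1) : ℝ) - condApprox s V ξ m n else 0 := by
      intro ξ
      simp only [X, transform_succ]
      split_ifs <;> push_cast <;> ring
    have hc : ∀ ξ, (X (m, n + 1) (concat (m, n) ω ξ) : ℝ) = X (m, n) ω + if h ω m n = true then
        (condApprox s V (concat (m, n) ω ξ) m (n + 1) : ℝ) - condApprox s V ω m n else 0 := by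
      intro ξ
      have he := eqOn_concat (m, n) ω ξ
      rw [hX, hXpast he, hpast he, condApprox_congr_past he]
    rw [expect]
    simp only [hc]
    by_cases hω : h ω m n = true
    · simp only [hω, if_true]
      have hint : Integrable (fun ξ => (condApprox s V (concat (m, n) ω ξ) m (n + 1) : ℝ))
          uniform := integrable_of_continuous ((continuous_condApprox m (n + 1)).comp
            ((continuous_concat (m, n)).comp (Continuous.prodMk_right ω)))
      have he := expect_condApprox (s := s) (V := V) ω m n
      rw [expect] at he
      have hsub : Integrable (fun ξ => (condApprox s V (concat (m, n) ω ξ) m (n + 1) : ℝ) -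
          condApprox s V ω m n) uniform := hint.sub (integrable_const _)
      rw [integral_add (integrable_const _) hsub, integral_sub hint (integrable_const _), he]
      simp
    · simp [hω]
  have hmart : ∀ q p, (Before q p ∨ q = p) → ∀ ω, expect q (fun ξ => (X p ξ : ℝ)) ω = X q ω := by
    intro q p hqp ω
    have hQ : ∀ m n, (Before q (m, n) ∨ q = (m, n)) →
        expect q (fun ξ => (X (m, n) ξ : ℝ)) ω = X q ω →
        expect q (fun ξ => (X (m, n + 1) ξ : ℝ)) ω = X q ω := by
      intro m n hq hmn
      rw [← hmn, ← expect_expect (hXcont (m, n + 1)) hq]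
      exact congrArg (expect q · ω) (funext fun ξ => hstep m n ξ)
    refine (lex_induction (K := fun m => s m + 1) (m := q.1) (n := q.2)
      (Q := fun m n => (Before q (m, n) ∨ q = (m, n)) ∧
        expect q (fun ξ => (X (m, n) ξ : ℝ)) ω = X q ω)
      ⟨Or.inr rfl, ?_⟩ ?_ ?_ (m' := p.1) (n' := p.2) ?_).2
    · exact expect_of_eqOn (fun ξ ξ' hξ => by rw [hXpast hξ]) ω
    · rintro m n ⟨hq, hmn⟩
      refine ⟨Or.inl ?_, hQ m n hq hmn⟩
      rcases hq with hq | rfl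
      · rcases hq with hq | hq
        · exact Or.inl hq
        · exact Or.inr ⟨hq.1, hq.2.trans (Nat.lt_succ_self n)⟩
      · exact Or.inr ⟨rfl, Nat.lt_succ_self n⟩
    · rintro m n hn ⟨hq, hmn⟩
      refine ⟨Or.inl (Or.inl ?_), ?_⟩
      · rcases hq with hq | rfl
        · rcases hq with hq | hq
          · exact hq.trans (Nat.lt_succ_self m)
          · exact hq.1.trans_lt (Nat.lt_succ_self m)
        · exact Nat.lt_succ_self m
      · rw [← hmn]
        have : ∀ ξ, X (m + 1, 0) ξ = X (m, n) ξ := fun ξ =>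
          congrArg (c + ·) (transform_row (h ξ) (condApprox_row ξ) hn).symm
        simp only [this]
    · rcases hqp with hqp | rfl
      · exact hqp.imp id fun h => ⟨h.1, h.2.le⟩
      · exact Or.inr ⟨rfl, le_rfl⟩
  refine ⟨⟨fun p => integrable_of_continuous (hXcont p), fun p => ⟨Set.univ, by simp,
    fun ω _ ω' _ hω => ?_⟩, fun q p hqp => Filter.Eventually.of_forall (hmart q p hqp)⟩, ?_⟩
  · exact congrArg _ (hXpast hω)
  · have hK : Computable fun m => s m + 1 := Computable.succ.comp hs
    obtain ⟨G, hG, hGX⟩ := (IsRatComputable.const c).add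
      (IsRatComputable.transform hK (h := fun σ => h (ofList σ))
        (e := fun σ => condApprox s V (ofList σ)) hcomp (isRatComputable_condApprox hs hV))
    have hTc : Computable T := by
      have hmax := Primrec.nat_max.to_comp.comp
        (Computable.snd.comp (Computable.snd (α := ℕ) (β := ℕ × ℕ)))
        (hs.comp (Computable.fst.comp (Computable.snd (α := ℕ) (β := ℕ × ℕ))))
      have hrec := Computable.nat_rec Computable.succ (Computable.const 0) hmax.to₂
      have hsup : ∀ k, Nat.rec (motive := fun _ => ℕ) 0 (fun i t => max t (s i)) k =
          (Finset.range k).sup s := by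
        intro k
        induction k with
        | zero => rfl
        | succ k ih => rw [Finset.range_add_one, Finset.sup_insert, ← ih]; exact max_comm _ _
      exact hrec.of_eq fun m => hsup (m + 1)
    have hswap : Computable fun y : (ℕ × ℕ) × List Bool => (y.2, y.1) :=
      Computable.pair Computable.snd Computable.fst
    refine ⟨_, isComputableFunctional_of_initialBits (hTc.comp Computable.fst) (hG.comp hswap),
      fun p ω => ?_⟩
    rw [hGX]
    have h1 : X p ω = X p (ofList (initialBits (hide (past p) ω) (T p.1))) := by
      rw [hXlist]
      exact hXpast (eqOn_hide (past p) ω).symm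
    exact congrArg _ h1

end Transform

/-! ### From divergence to a martingale that tends to infinity -/

theorem rowPast_eq_past (m : ℕ) : rowPast m = past (m, 0) := by
  ext q
  simp [rowPast, past, Before]

theorem rowExpect_eq_expect (m : ℕ) : rowExpect m = expect (m, 0) := by
  funext f ω
  have : ∀ ξ, rowConcat m ω ξ = concat (m, 0) ω ξ := fun ξ => by
    funext q
    simp only [rowConcat, concat, Before, Nat.not_lt_zero, and_false, or_false, Nat.sub_zero]
    split_ifs with h1 h2
    · rfl
    · rw [h2, Nat.sub_self]
    · rfl
  simp only [rowExpect, expect, this]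

/-- Almost everywhere equal continuous functions are equal, since `uniform` has full support. -/
theorem IsMartingale.expect_eq_everywhere {M : ℕ × ℕ → BitArray → ℝ} (hM : IsMartingale M)
    (hc : ∀ p, Continuous (M p)) {q p : ℕ × ℕ} (hqp : Before q p ∨ q = p) :
    expect q (M p) = M q :=
  (Continuous.ae_eq_iff_eq uniform (continuous_expect (hc p) q) (hc q)).1 (hM.expect_eq q p hqp)

theorem IsRowMartingale.expect_eq_everywhere {N : ℕ → BitArray → ℝ} (hN : IsRowMartingale N)
    (hc : ∀ m, Continuous (N m)) {l m : ℕ} (hlm : l ≤ m) : expect (l, 0) (N m) = N l := by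
  rw [← rowExpect_eq_expect]
  refine (Continuous.ae_eq_iff_eq uniform ?_ (hc l)).1 (hN.expect_eq l m hlm)
  rw [rowExpect_eq_expect]
  exact continuous_expect (hc m) _

theorem IsComputableMartingale.rows {M : ℕ × ℕ → BitArray → ℝ} (hM : IsComputableMartingale M) :
    IsComputableRowMartingale fun m => M (m, 0) := by
  refine ⟨⟨fun m => hM.1.integrable _, fun m => ?_, fun l m hlm => ?_⟩, ?_⟩
  · rw [rowPast_eq_past]
    exact hM.1.adapted _
  · rw [rowExpect_eq_expect]
    refine hM.1.expect_eq _ _ ?_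
    rcases hlm.lt_or_eq with h | rfl
    · exact Or.inl (Or.inl h)
    · exact Or.inr rfl
  · obtain ⟨g, hg, hgM⟩ := hM.2
    have hf : Computable fun y : ℕ × ℕ => ((y.1, 0), y.2) :=
      Computable.pair (Computable.pair Computable.fst (Computable.const 0)) Computable.snd
    refine ⟨_, hg.comp hf, fun m ω => ?_⟩
    rw [rowPast_eq_past]
    exact hgM (m, 0) ω

theorem IsComputableRationalMartingale.isComputableMartingale {M : ℕ × ℕ → BitArray → ℝ}
    (hM : IsComputableRationalMartingale M) : IsComputableMartingale M := by
  obtain ⟨hM, g, hg, hgM⟩ := hM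
  refine ⟨hM, _, hg.comp (Computable.fst (α := ℕ × ℕ) (β := ℕ)), fun t ω => ?_⟩
  simp only [hgM]
  exact ⟨fun i j _ => by simp, tendsto_const_nhds⟩

/-- If the conditional expectations of a nonnegative computable martingale indexed by the rows
diverge on `ω`, then a rational-valued computable martingale tends to infinity on `ω`. -/
theorem exists_lexLiminf_eq_top {N : ℕ → BitArray → ℝ} (hN : IsComputableRowMartingale N)
    (hpos : ∀ m ξ, 0 ≤ N m ξ) {ω : BitArray}
    (hdiv : Diverges fun p => expect p (N (p.1 + 1)) ω) :
    ∃ M : ℕ × ℕ → BitArray → ℝ, IsComputableRationalMartingale M ∧ (∀ p ξ, 0 ≤ M p ξ) ∧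
      lexLiminf (fun p => M p ω) = ⊤ ∧
      ∃ k : ℕ → ℕ, Computable k ∧ ∀ m n, k m ≤ n → ∀ ξ, M (m, n) ξ = M (m + 1, 0) ξ := by
  have hc : ∀ m, Continuous (N m) := continuous_of_computablyAdapted hN.2
  obtain ⟨g, hg, hgN⟩ := hN.2
  have hidx : Computable fun m : ℕ => (m + 1, m + 1) :=
    Computable.pair Computable.succ Computable.succ
  obtain ⟨s, hs, V, hV, hgV⟩ := (hg.comp hidx).exists_use
  have happrox : ∀ m ξ, |(approx s V m ξ : ℝ) - N (m + 1) ξ| ≤ (1 / 2) ^ (m + 1) := by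
    intro m ξ
    have := (hgN (m + 1) ξ).abs_sub_le (m + 1)
    rw [hgV m] at this
    exact this
  let x : BitArray → ℕ → ℕ → ℝ := fun ξ m n => expect (m, n) (N (m + 1)) ξ
  have hx : ∀ ξ m n, 0 ≤ x ξ m n := fun ξ m n => integral_nonneg fun η => hpos _ _
  have hx0 : ∀ ξ m, x ξ m 0 = N m ξ := fun ξ m =>
    congrFun (hN.1.expect_eq_everywhere hc (Nat.le_succ m)) ξ
  have hclose : ∀ ξ m n, |(condApprox s V ξ m n : ℝ) - x ξ m n| ≤ (1 / 2) ^ (m + 1) := by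
    intro ξ m n
    have hcc : Continuous fun η => concat (m, n) ξ η :=
      (continuous_concat (m, n)).comp (Continuous.prodMk_right ξ)
    rw [condApprox_eq_expect, expect]
    simp only [x, expect]
    have hi : Integrable (fun η => (approx s V m (concat (m, n) ξ η) : ℝ)) uniform :=
      integrable_of_continuous ((continuous_approx m).comp hcc)
    have hi' : Integrable (fun η => N (m + 1) (concat (m, n) ξ η)) uniform :=
      integrable_of_continuous ((hc (m + 1)).comp hcc)
    rw [← integral_sub hi hi', ← Real.norm_eq_abs]
    refine (norm_integral_le_of_norm_le_const (C := (1 / 2) ^ (m + 1))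
      (Filter.Eventually.of_forall fun η => happrox m _)).trans ?_
    simp
  have hclose' : ∀ ξ m,
      |(condApprox s V ξ m (s m + 1) : ℝ) - x ξ (m + 1) 0| ≤ (1 / 2) ^ (m + 1) := by
    intro ξ m
    rw [condApprox_eq_approx ξ (Nat.le_succ (s m)), hx0]
    exact happrox m ξ
  -- the errors of the price add up to at most `2`, so this initial value keeps it nonnegative
  obtain ⟨c, hcx⟩ := exists_rat_gt (x ω 0 0 + 2)
  have hcξ : ∀ ξ, x ξ 0 0 + 2 ≤ c := by
    intro ξ
    have : x ξ 0 0 = x ω 0 0 := expect_congr (fun q hq => by simp [past, Before] at hq) _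
    rw [this]
    exact hcx.le
  -- the approximation of row `m` is known from column `s m` on; one more makes the bound positive
  let K : ℕ → ℕ := fun m => s m + 1
  have hK : Computable K := Computable.succ.comp hs
  have hKpos : ∀ m, 0 < K m := fun m => Nat.succ_pos _
  have hprice : ∀ ξ m n, 0 ≤ price K c (condApprox s V ξ) m n := by
    intro ξ m n
    have h1 := price_ge (K := K) (hclose ξ) (hclose' ξ) (hcξ ξ) m n
    exact_mod_cast (hx ξ m n).trans h1
  have hpdiv : Diverges fun p => (price K c (condApprox s V ω) p.1 p.2 : ℝ) :=
    Diverges.price (hclose ω) (hclose' ω) hdiv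
  rcases hpdiv.eventually_or_crosses fun p => by exact_mod_cast hprice ω p.1 p.2 with
    hlim | ⟨a, b, hab, hlow, hhigh⟩
  · refine ⟨fun p ξ => (price K c (condApprox s V ξ) p.1 p.2 : ℝ), ?_, fun p ξ => ?_,
      lexLiminf_eq_top_iff.2 hlim, K, hK, fun m n hn ξ => ?_⟩
    · exact isComputableRationalMartingale_transform hs hV (fun _ => rfl) (fun _ _ => rfl)
        (Computable.const true)
    · exact Rat.cast_nonneg.2 (hprice ξ p.1 p.2)
    · exact congrArg _ (price_row (condApprox_row ξ) hn)
  · have hlow' : ∃ᶠ p in lexAtTop, price K c (condApprox s V ω) p.1 p.2 < a :=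
      hlow.mono fun p hp => by exact_mod_cast hp
    have hhigh' : ∃ᶠ p in lexAtTop, b < price K c (condApprox s V ω) p.1 p.2 :=
      hhigh.mono fun p hp => by exact_mod_cast hp
    have ha : 0 ≤ a := by
      obtain ⟨m, n, -, hmn⟩ := frequently_lexAtTop hlow' 0
      exact ((hprice ω m n).trans_lt hmn).le
    refine ⟨fun p ξ => (capital K a b c (condApprox s V ξ) p.1 p.2 : ℝ), ?_, fun p ξ => ?_,
      lexLiminf_eq_top_iff.2 (eventually_le_capital hab hKpos (condApprox_row ω) ha (hprice ω)
        hlow' hhigh'), K, hK, fun m n hn ξ => ?_⟩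
    · have hpc := (IsRatComputable.const c).add (IsRatComputable.transform hK
        (h := fun (_ : List Bool) _ _ => true) (e := fun σ => condApprox s V (ofList σ))
        (Computable.const true) (isRatComputable_condApprox hs hV))
      have hflag := computable_flag hK a b
        (p := fun σ => price K c (condApprox s V (ofList σ))) hpc
      have hpast : ∀ {ξ ξ' : BitArray} {m n : ℕ}, Set.EqOn ξ ξ' (past (m, n)) →
          flag K a b (price K c (condApprox s V ξ)) m n =
            flag K a b (price K c (condApprox s V ξ')) m n := by
        intro ξ ξ' m n hξ
        refine flag_congr fun i j hij => price_congr fun i' j' hij' =>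
          condApprox_congr_past (hξ.mono (past_subset ?_))
        simp only [Before, Prod.mk.injEq]
        omega
      have hbits : ∀ {ξ ξ' : BitArray} {m : ℕ},
          (∀ i ≤ m, initialBits ξ (s i) = initialBits ξ' (s i)) → ∀ n,
          flag K a b (price K c (condApprox s V ξ)) m n =
            flag K a b (price K c (condApprox s V ξ')) m n := fun {ξ ξ' m} hξ n =>
        flag_congr fun i j hij => price_congr fun i' j' hij' =>
          condApprox_congr_bits (hξ i' (by omega)) j'
      exact isComputableRationalMartingale_transform (c := a)
        (h := fun ξ => flag K a b (price K c (condApprox s V ξ))) hs hV hpast hbits hflag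
    · exact Rat.cast_nonneg.2
        (capital_nonneg hab hKpos (condApprox_row ξ) ha (hprice ξ) p.1 p.2)
    · exact congrArg _ (capital_row (condApprox_row ξ) hn)

end DoobArray

theorem mainTheorem8 (ω : DoobArray.BitArray) :
    List.TFAE [
      ¬ DoobArray.IsDoobRandom ω,
      ∃ M : ℕ × ℕ → DoobArray.BitArray → ℝ,
        DoobArray.IsComputableMartingale M ∧ (∀ p ξ, 0 ≤ M p ξ) ∧
          DoobArray.Diverges (fun p => M p ω),
      ∃ M : ℕ × ℕ → DoobArray.BitArray → ℝ,
        DoobArray.IsComputableRationalMartingale M ∧ (∀ p ξ, 0 ≤ M p ξ) ∧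
          DoobArray.Diverges (fun p => M p ω),
      ∃ M : ℕ × ℕ → DoobArray.BitArray → ℝ,
        DoobArray.IsComputableRationalMartingale M ∧ (∀ p ξ, 0 ≤ M p ξ) ∧
          DoobArray.lexLiminf (fun p => M p ω) = ⊤ ∧
          ∃ k : ℕ → ℕ, Computable k ∧
            ∀ m n, k m ≤ n → ∀ ξ, M (m, n) ξ = M (m + 1, 0) ξ] := by
  open DoobArray in
  tfae_have 1 → 4 := by
    intro h
    simp only [IsDoobRandom, not_forall] at h
    obtain ⟨N, hN, hpos, hdiv⟩ := h
    have hc : ∀ m, Continuous (N m) := continuous_of_computablyAdapted hN.2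
    refine exists_lexLiminf_eq_top hN hpos fun ⟨a, ha⟩ => hdiv ⟨a, ?_⟩
    have hm : Filter.Tendsto (fun m : ℕ => (m, 0)) Filter.atTop lexAtTop :=
      Filter.tendsto_comap_iff.2 Filter.tendsto_id
    refine ((convergesTo_iff_tendsto.1 ha).comp hm).congr fun m => ?_
    exact congrFun (hN.1.expect_eq_everywhere hc (Nat.le_succ m)) ω
  tfae_have 4 → 3 := fun ⟨M, hM, hpos, hlim, _⟩ =>
    ⟨M, hM, hpos, DoobArray.diverges_of_lexLiminf_eq_top hlim⟩
  tfae_have 3 → 2 := fun ⟨M, hM, h⟩ => ⟨M, hM.isComputableMartingale, h⟩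
  tfae_have 2 → 4 := by
    rintro ⟨M, hM, hpos, hdiv⟩
    have hc : ∀ p, Continuous (M p) := DoobArray.continuous_of_computablyAdapted hM.2
    refine DoobArray.exists_lexLiminf_eq_top hM.rows (fun m => hpos (m, 0)) ?_
    have h : ∀ p : ℕ × ℕ, DoobArray.expect p (M (p.1 + 1, 0)) = M p := fun p =>
      hM.1.expect_eq_everywhere hc (Or.inl (Or.inl (Nat.lt_succ_self p.1)))
    simpa only [h] using hdiv
  tfae_have 4 → 1 := by
    rintro ⟨M, hM, hpos, hlim, -⟩ hω
    obtain ⟨a, ha⟩ := hω _ hM.isComputableMartingale.rows fun m => hpos (m, 0)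
    obtain ⟨k, hk⟩ := DoobArray.eventually_lexAtTop.1
      (DoobArray.lexLiminf_eq_top_iff.1 hlim (a + 1))
    have h1 : a + 1 ≤ a := ge_of_tendsto ha
      (Filter.eventually_atTop.2 ⟨k, fun m hm => hk m 0 hm⟩)
    linarith
  tfae_finish
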